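/- Let $\gamma\in\mathbb{R}$, $\mathrm{SNR}>0$, $L=\sqrt{12}$, $\mathcal I=[-L/2,L/2)=[-\sqrt3,\sqrt3)$. For reals $a<b$ let $x_{\bmod[a,b)}$ be the unique element of $x+(b-a)\mathbb{Z}$ in $[a,b)$, and let $x^*=x_{\bmod[-L/2,L/2)}$ (coordinatewise for vectors). Consider the modulo-additive multiple access channel $\mathbf y=[\mathbf x_1+\gamma\mathbf x_2+\mathbf z]^*$, where the coordinates of $\mathbf z\in\mathbb{R}^n$ are i.i.d. Gaussian with mean $0$ and variance $1/\mathrm{SNR}$. A linear code of length $n$ with $M$ messages consists of one encoder $f:\{1,\dots,M\}\to\mathcal I^n$, used by both users, such that for all $w_1,w_2$ there is a $w_3$ with $[f(w_1)+f(w_2)]^*=f(w_3)$, and a (measurable) decoder $g:\mathcal I^n\to\{1,\dots,M\}^2$. For independent uniform messages $w_1,w_2$, independent of $\mathbf z$, its error probability is $P_e=\Pr\big(g([f(w_1)+\gamma f(w_2)+\mathbf z]^*)\ne(w_1,w_2)\big)$, and it satisfies the power constraint if $\frac1n\mathbb{E}\|f(w_1)\|^2\le1$. A symmetric rate $R$ is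 achievable if for every $\epsilon>0$ and all sufficiently large $n$ there is a linear code of length $n$ with at least $2^{nR}$ messages that satisfies the power constraint and has $P_e<\epsilon$. Define, for a prime $p$, $$\delta(p,\gamma)=\min_{1\le l\le p-1} l\left|\gamma-\frac{\lfloor l\gamma\rceil}{l}\right|,$$ where $\lfloor x\rceil$ is the integer nearest to $x$, and let $\mathcal P'(\gamma)$ be the (finite, possibly empty) set of primes $p$ with $$e^{-\frac{3\mathrm{SNR}}{2p^2}\left(\gamma_{\bmod[-\frac14,\frac14)}\right)^2}<1-2p\,e^{-\frac{3\mathrm{SNR}}8}.$$ Then every symmetric rate $$R<\max_{p\in\mathcal P'(\gamma)}\min\left\{-\tfrac12\log_2\!\left(\tfrac1{p^2}+\sqrt{\tfrac{2\pi/3}{\mathrm{SNR}}}+\tfrac1p e^{-\frac{3\mathrm{SNR}}{2p^2}\delta^2(p,\gamma)}+2e^{-\frac{3\mathrm{SNR}}8}\right),\ -\log_2\!\left(\tfrac1p+\sqrt{\tfrac{2\pi/3}{\delta^2(p,\gamma)\,\mathrm{SNR}}}+2e^{-\frac{3\mathrm{SNR}}8}\right)\right\}$$ is achievable, where the second expression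 is $-\infty$ if $\delta(p,\gamma)=0$, and the maximum over the empty set is $-\infty$. -/

import Mathlib

open MeasureTheory ProbabilityTheory

namespace LinearMAC

noncomputable section

/-- Reduction of a real number modulo the half-open interval `[a, b)`: the unique
`x - m * (b - a)`, `m` an integer, that lies in `[a, b)`. -/
def modIco (a b : ℝ) (hab : a < b) (x : ℝ) : ℝ :=
  toIcoMod (sub_pos.2 hab) a x

/-- The length `L = √12` of the basic interval. -/
def L : ℝ := √12

lemma L_pos : 0 < L := Real.sqrt_pos.2 (by norm_num)

lemma neg_half_L_lt : -(L / 2) < L / 2 := by linarith [L_pos]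

/-- The basic interval `[-L/2, L/2) = [-√3, √3)`. -/
def basicInterval : Set ℝ := Set.Ico (-(L / 2)) (L / 2)

/-- `x^*`, the reduction of `x` modulo the basic interval. -/
def star (x : ℝ) : ℝ := modIco (-(L / 2)) (L / 2) neg_half_L_lt x

/-- The law of `n` i.i.d. Gaussian noise samples with mean `0` and variance `1 / SNR`. -/
def noise (n : ℕ) (snr : ℝ) : Measure (Fin n → ℝ) :=
  Measure.pi fun _ => gaussianReal 0 (1 / snr).toNNReal

/-- The output `[x₁ + γ x₂ + z]^*` of the modulo-additive channel, coordinate by coordinate. -/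
def channelOutput {n : ℕ} (γ : ℝ) (x₁ x₂ z : Fin n → ℝ) : Fin n → ℝ :=
  fun t => star (x₁ t + γ * x₂ t + z t)

/-- A code of blocklength `n` with `M` messages per user: one encoding function, used by both
users, with values in the `n`-th power of the basic interval, and one (measurable) decoding
function. The decoder is only ever applied to points of the `n`-th power of the basic interval. -/
structure Code (n M : ℕ) where
  enc : Fin M → Fin n → ℝ
  enc_mem : ∀ w t, enc w t ∈ basicInterval
  dec : (Fin n → ℝ) → Fin M × Fin M
  measurable_dec : Measurable dec

/-- Linearity: the codebook is closed under addition modulo the basic interval. -/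
def Code.IsLinear {n M : ℕ} (C : Code n M) : Prop :=
  ∀ w₁ w₂ : Fin M, ∃ w₃ : Fin M, (fun t => star (C.enc w₁ t + C.enc w₂ t)) = C.enc w₃

/-- The average power `(1/n) E‖x‖²` of the transmitted codeword, for a uniform message. -/
def Code.power {n M : ℕ} (C : Code n M) : ℝ :=
  (1 / (n : ℝ)) * ((1 / (M : ℝ)) * ∑ w : Fin M, ∑ t : Fin n, C.enc w t ^ 2)

/-- The probability that the decoded pair of messages differs from the transmitted one, the two
messages being independent and uniform, and independent of the noise. -/
def Code.errorProb {n M : ℕ} (C : Code n M) (γ snr : ℝ) : ℝ :=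
  (1 / (M : ℝ) ^ 2) * ∑ w : Fin M × Fin M,
    (noise n snr).real {z | C.dec (channelOutput γ (C.enc w.1) (C.enc w.2) z) ≠ w}

/-- The symmetric rate `R` (bits per channel use) is achievable with one linear code: for every
`ε > 0` and all large `n` there is a linear code of length `n`, with at least `2^(nR)` messages
per user, that obeys the power constraint and has error probability below `ε`. -/
def Achievable (γ snr R : ℝ) : Prop :=
  ∀ ε : ℝ, 0 < ε → ∃ N : ℕ, ∀ n : ℕ, N ≤ n →
    ∃ (M : ℕ) (C : Code n M), (2 : ℝ) ^ ((n : ℝ) * R) ≤ (M : ℝ) ∧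
      C.IsLinear ∧ C.power ≤ 1 ∧ C.errorProb γ snr < ε

/-- `δ(p, γ)`, the minimum over `l = 1, …, p - 1` of `l * |γ - ⌊lγ⌉ / l|`
(for `p ≥ 2`, the infimum of a nonempty finite set). -/
def delta (p : ℕ) (γ : ℝ) : ℝ :=
  sInf ((fun l : ℕ => (l : ℝ) * |γ - (round ((l : ℝ) * γ) : ℝ) / (l : ℝ)|) '' Set.Ioo 0 p)

/-- The set `P'(γ)` of primes over which the rate is optimized. -/
def admissiblePrimes (γ snr : ℝ) : Set ℕ :=
  {p | p.Prime ∧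
    Real.exp (-(3 * snr / (2 * (p : ℝ) ^ 2)) *
        modIco (-(1 / 4)) (1 / 4) (by norm_num) γ ^ 2) <
      1 - 2 * (p : ℝ) * Real.exp (-(3 * snr / 8))}

/-- The first of the two rate expressions. -/
def rateA (γ snr : ℝ) (p : ℕ) : ℝ :=
  -(1 / 2) * Real.logb 2
    (1 / (p : ℝ) ^ 2 + √((2 * Real.pi / 3) / snr) +
      1 / (p : ℝ) * Real.exp (-(3 * snr / (2 * (p : ℝ) ^ 2)) * delta p γ ^ 2) +
      2 * Real.exp (-(3 * snr / 8)))

/-- The second of the two rate expressions, for `δ(p, γ) ≠ 0`. -/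
def rateB (γ snr : ℝ) (p : ℕ) : ℝ :=
  -Real.logb 2
    (1 / (p : ℝ) + √((2 * Real.pi / 3) / (delta p γ ^ 2 * snr)) +
      2 * Real.exp (-(3 * snr / 8)))

open Classical in
/-- The minimum of the two rate expressions. If `δ(p, γ) = 0` then the argument of the logarithm
in the second expression is `+∞`, and the minimum is `-∞`. -/
def primeRate (γ snr : ℝ) (p : ℕ) : EReal :=
  if delta p γ = 0 then ⊥ else ((min (rateA γ snr p) (rateB γ snr p) : ℝ) : EReal)

/-- The maximum of `primeRate` over the admissible primes (finitely many when `SNR > 0`);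
it is `-∞` if there are none. -/
def rateBound (γ snr : ℝ) : EReal :=
  ⨆ p ∈ admissiblePrimes γ snr, primeRate γ snr p

end

end LinearMAC

/-! ### Gaussian sums over separated points, and mean score ratios on the circle. -/

namespace LinearMAC

noncomputable section

/-! For an odd prime q, the codebook is the image of a random linear code over `ZMod q` under the
map sending a to L/q times its centred representative. Addition modulo q becomes addition modulo the
basic interval, and a uniform symbol has power 1 - 1/q².

Decoding is by pairwise comparison. By Markov's inequality, a wrong pair w' scores at least as well
as the true pair w with probability at most a product of factors `meanRatio`, one per coordinate
(`exists_decoder`). `distScore` is, up to a constant, the square root of the Gaussian density taken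
at the reduced point. Its mean ratio at L·u is at most the theta series with terms exp(-(3
SNR/2)(u+k)²), and sums of these over separated points of the circle are compared with a Gaussian
integral (`sum_meanRatio_le`).

The generator columns are independent and uniform, so it remains to average one factor over one
column. Let w have independent components. If w' adds two dimensions to the span of w, its labels
are uniform on the plane and the average is at most A. If w' adds exactly one, the average over
lines gives B, and there are only O(q^k) such w'. If w' lies in the span, there are at most q⁴
choices, so any average θ < 1 suffices; `cosScore` with a small parameter provides it as soon as w
and w' are distinguishable without noise. The error is at most (q+1)/q^k + q⁴θⁿ + O(q^k)Bⁿ +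
q^(2k)Aⁿ. With q^k of order 2^(nR) it vanishes when 2^(2R)A < 1 and 2^R B < 1.

For odd p with δ ≠ 0, take q = p: the separations 1/p and δ/p on the circle give as A and B the
arguments of the two logarithms without the terms 2exp(-3SNR/8). For p = 2, a large prime q replaces
the binary constellation. Put τ = √((2π/3)/SNR) and let d be the distance from γ to the integers.
Then A = 1/q + τ, and B tends to 1/2 + τ/d; the latter holds because an orbit of a circle rotation
splits into few blocks that do not wrap around (`sum_rotation_le_half`). Admissibility of 2 ensures
that 2γ is not an integer. -/

/-- A Gaussian sum over points at mutual distance at least `h`, all at distance at least `e` from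
the origin, is at most one extreme term plus the Gaussian integral divided by `h`. -/
lemma sum_exp_le_of_separated {ι : Type*} (s : Finset ι) (f : ι → ℝ) {h b e : ℝ}
    (hh : 0 < h) (hb : 0 < b) (he : 0 ≤ e)
    (hsep : ∀ i ∈ s, ∀ j ∈ s, i ≠ j → h ≤ |f i - f j|) (hmin : ∀ i ∈ s, e ≤ |f i|) :
    ∑ i ∈ s, Real.exp (-b * f i ^ 2) ≤ Real.exp (-b * e ^ 2) + √(Real.pi / b) / h := by
  classical
  rcases s.eq_empty_or_nonempty with rfl | hs
  · simp only [Finset.sum_empty]; positivity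
  obtain ⟨i₀, hi₀, hi₀min⟩ := s.exists_min_image (fun i => |f i|) hs
  have hanti : ∀ {x y : ℝ}, |x| ≤ |y| → Real.exp (-b * y ^ 2) ≤ Real.exp (-b * x ^ 2) := by
    intro x y hxy
    have := sq_le_sq.2 hxy
    exact Real.exp_le_exp.2 (by nlinarith)
  -- Every point other than the one nearest the origin gets an interval of length h on its side
  -- facing `f i₀`. Separation from `f i₀` makes the Gaussian on it at least the value at `f i`, and
  -- separation between the points makes these intervals disjoint, so h times the sum is at most the
  -- integral.
  let J : ι → Set ℝ := fun i =>
    if f i₀ < f i then Set.Ioo (f i - h) (f i) else Set.Ioo (f i) (f i + h)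
  have hJm : ∀ i, MeasurableSet (J i) := by
    intro i; simp only [J]; split_ifs <;> exact measurableSet_Ioo
  have hJvol : ∀ i, volume.real (J i) = h := by
    intro i; simp only [J]
    split_ifs <;> rw [Real.volume_real_Ioo_of_le (by linarith)] <;> ring
  have hge : ∀ i ∈ s, i ≠ i₀ → ∀ y ∈ J i, Real.exp (-b * f i ^ 2) ≤ Real.exp (-b * y ^ 2) := by
    intro i hi hne y hy
    apply hanti
    have h1 := hi₀min i hi
    have h2 := hsep i hi i₀ hi₀ hne
    simp only [J] at hy
    split_ifs at hy with hlt
    · rw [abs_of_pos (by linarith)] at h2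
      have hpos : 0 ≤ f i := by
        by_contra hn
        rw [abs_of_neg (by linarith), abs_of_neg (by linarith)] at h1
        linarith
      rw [abs_of_nonneg hpos] at h1 ⊢
      have := abs_le.1 h1
      rw [abs_le]; constructor <;> linarith [hy.1, hy.2]
    · rw [abs_of_nonpos (by linarith)] at h2
      have hneg : f i ≤ 0 := by
        by_contra hn
        rw [abs_of_pos (by linarith), abs_of_pos (by linarith)] at h1
        linarith
      rw [abs_of_nonpos hneg] at h1 ⊢
      have := abs_le.1 h1
      rw [abs_le]; constructor <;> linarith [hy.1, hy.2]
  have hdisj : ∀ i ∈ s, ∀ j ∈ s, i ≠ i₀ → j ≠ i₀ → i ≠ j → ∀ y, y ∈ J i → y ∉ J j := by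
    intro i hi j hj hi0 hj0 hij y hyi hyj
    have h1 := hsep i hi j hj hij
    have h2 := hsep i hi i₀ hi₀ hi0
    have h3 := hsep j hj i₀ hi₀ hj0
    simp only [J] at hyi hyj
    split_ifs at hyi hyj with c1 c2 c2 <;>
    · rcases abs_cases (f i - f j) with h1' | h1' <;>
      rcases abs_cases (f i - f i₀) with h2' | h2' <;>
      rcases abs_cases (f j - f i₀) with h3' | h3' <;>
      linarith [hyi.1, hyi.2, hyj.1, hyj.2]
  have hint : Integrable (fun x : ℝ => Real.exp (-b * x ^ 2)) := integrable_exp_neg_mul_sq hb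
  have hintJ : ∀ i ∈ s.erase i₀,
      Integrable ((J i).indicator fun _ => Real.exp (-b * f i ^ 2)) := by
    intro i _
    refine (integrable_indicator_iff (hJm i)).2 (integrableOn_const ?_)
    simp only [J]; split_ifs <;> simp
  have hkey : ∑ i ∈ s.erase i₀, Real.exp (-b * f i ^ 2) * h ≤ √(Real.pi / b) := by
    rw [← integral_gaussian]
    calc ∑ i ∈ s.erase i₀, Real.exp (-b * f i ^ 2) * h
        = ∑ i ∈ s.erase i₀, ∫ y, (J i).indicator (fun _ => Real.exp (-b * f i ^ 2)) y := by
          refine Finset.sum_congr rfl fun i _ => ?_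
          rw [integral_indicator (hJm i), setIntegral_const, hJvol, smul_eq_mul, mul_comm]
      _ = ∫ y, ∑ i ∈ s.erase i₀, (J i).indicator (fun _ => Real.exp (-b * f i ^ 2)) y :=
          (integral_finsetSum _ hintJ).symm
      _ ≤ ∫ y, Real.exp (-b * y ^ 2) := by
          refine integral_mono (integrable_finsetSum _ hintJ) hint fun y => ?_
          by_cases hy : ∃ i ∈ s.erase i₀, y ∈ J i
          · obtain ⟨i, hi, hyi⟩ := hy
            have hi' := Finset.mem_erase.1 hi
            show ∑ i ∈ s.erase i₀, (J i).indicator (fun _ => Real.exp (-b * f i ^ 2)) y ≤ _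
            rw [Finset.sum_eq_single_of_mem i hi]
            · rw [Set.indicator_of_mem hyi]
              exact hge i hi'.2 hi'.1 y hyi
            · intro j hj hji
              have hj' := Finset.mem_erase.1 hj
              exact Set.indicator_of_notMem
                (hdisj i hi'.2 j hj'.2 hi'.1 hj'.1 (Ne.symm hji) y hyi) _
          · push Not at hy
            show ∑ i ∈ s.erase i₀, (J i).indicator (fun _ => Real.exp (-b * f i ^ 2)) y ≤ _
            rw [Finset.sum_eq_zero fun i hi => Set.indicator_of_notMem (hy i hi) _]
            positivity
  rw [← Finset.add_sum_erase s _ hi₀]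
  refine add_le_add (hanti ?_) ?_
  · rw [abs_of_nonneg he]; exact hmin i₀ hi₀
  · rw [le_div_iff₀ hh, Finset.sum_mul]; exact hkey

/-- The lattice translates of a finite family of points on the circle `ℝ / ℤ`. -/
lemma sum_tsum_exp_le_of_separated {ι : Type*} (s : Finset ι) (u : ι → ℝ) {h b e : ℝ}
    (hh : 0 < h) (hh1 : h ≤ 1) (hb : 0 < b) (he : 0 ≤ e)
    (hsep : ∀ i ∈ s, ∀ j ∈ s, i ≠ j → ∀ k : ℤ, h ≤ |u i - u j + k|)
    (hmin : ∀ i ∈ s, ∀ k : ℤ, e ≤ |u i + k|) :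
    ∑ i ∈ s, ∑' k : ℤ, ENNReal.ofReal (Real.exp (-b * (u i + k) ^ 2)) ≤
      ENNReal.ofReal (Real.exp (-b * e ^ 2) + √(Real.pi / b) / h) := by
  rw [← Summable.tsum_finsetSum fun _ _ => ENNReal.summable, ENNReal.tsum_eq_iSup_sum]
  refine iSup_le fun K => ?_
  rw [Finset.sum_comm, ← Finset.sum_product',
    ← ENNReal.ofReal_sum_of_nonneg fun _ _ => (Real.exp_pos _).le]
  refine ENNReal.ofReal_le_ofReal
    (sum_exp_le_of_separated (s ×ˢ K) (fun x => u x.1 + x.2) hh hb he ?_ ?_)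
  · rintro ⟨i, k⟩ hi ⟨j, l⟩ hj hne
    rw [Finset.mem_product] at hi hj
    by_cases hij : i = j
    · subst hij
      have hkl : k - l ≠ 0 := fun h0 => hne (by rw [sub_eq_zero.1 h0])
      have : (1 : ℝ) ≤ |((k - l : ℤ) : ℝ)| := by
        rw [← Int.cast_abs]; exact_mod_cast Int.one_le_abs hkl
      refine hh1.trans (this.trans_eq ?_)
      push_cast; congr 1; ring
    · refine (hsep i hi.1 j hj.1 hij (k - l)).trans_eq ?_
      push_cast; congr 1; ring
  · rintro ⟨i, k⟩ hi
    exact hmin i (Finset.mem_product.1 hi).1 k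

lemma star_mem (x : ℝ) : star x ∈ Set.Ico (-(L / 2)) (L / 2) := by
  have h := toIcoMod_mem_Ico (sub_pos.2 neg_half_L_lt) (-(L / 2)) x
  have e : -(L / 2) + (L / 2 - -(L / 2)) = L / 2 := by ring
  rw [e] at h
  exact h

lemma exists_star_eq (x : ℝ) : ∃ k : ℤ, star x = x + k * L := by
  refine ⟨-toIcoDiv (sub_pos.2 neg_half_L_lt) (-(L / 2)) x, ?_⟩
  rw [star, modIco, toIcoMod, zsmul_eq_mul]
  push_cast; ring

lemma star_eq_of_mem {x y : ℝ} (hy : y ∈ basicInterval) (k : ℤ) (h : x = y + k * L) :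
    star x = y := by
  rw [star, modIco, toIcoMod_eq_iff]
  refine ⟨⟨hy.1, ?_⟩, k, ?_⟩
  · linarith [hy.2]
  · rw [h, zsmul_eq_mul]; ring

lemma star_add_int_mul (x : ℝ) (k : ℤ) : star (x + k * L) = star x := by
  obtain ⟨m, hm⟩ := exists_star_eq x
  refine star_eq_of_mem (star_mem x) (k - m) ?_
  rw [hm]; push_cast; ring

lemma abs_star_le (x : ℝ) : |star x| ≤ L / 2 := by
  have := star_mem x
  exact abs_le.2 ⟨this.1, this.2.le⟩

lemma star_sq_le (x : ℝ) : star x ^ 2 ≤ x ^ 2 := by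
  by_cases hx : x ∈ basicInterval
  · rw [star_eq_of_mem hx 0 (by simp)]
  · refine sq_le_sq.2 ((abs_star_le x).trans ?_)
    by_contra hn
    push Not at hn
    rw [abs_lt] at hn
    exact hx ⟨hn.1.le, hn.2⟩

lemma measurable_star : Measurable star := by
  have : star = fun x => x - (⌊(x - -(L / 2)) / (L / 2 - -(L / 2))⌋ : ℤ) * (L / 2 - -(L / 2)) := by
    ext x
    rw [star, modIco, toIcoMod, toIcoDiv_eq_floor, zsmul_eq_mul]
  rw [this]
  fun_prop

lemma L_sq : L ^ 2 = 12 := Real.sq_sqrt (by norm_num)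

/-- The law of one noise sample. -/
def noiseLaw (snr : ℝ) : Measure ℝ := gaussianReal 0 (1 / snr).toNNReal

instance (snr : ℝ) : IsProbabilityMeasure (noiseLaw snr) := by
  unfold noiseLaw; infer_instance

/-- The mean of the ratio of scores of a point shifted by `Δ` and of the true point, when the
scoring function is `s`. -/
def meanRatio (snr : ℝ) (s : ℝ → ℝ) (Δ : ℝ) : ℝ := ∫ z, s (z + Δ) / s z ∂noiseLaw snr

/-- The score of the minimum distance decoder. -/
def distScore (snr : ℝ) (x : ℝ) : ℝ := Real.exp (-(snr / 4) * star x ^ 2)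

/-- The Bhattacharyya bound: the factor snr/4 is half the exponent of the density, and completing
the square leaves -(snr/4)c² + (snr/8)c². -/
lemma lintegral_exp_shift {snr : ℝ} (hsnr : 0 < snr) (c : ℝ) :
    ∫⁻ z, ENNReal.ofReal (Real.exp (-(snr / 4) * ((z + c) ^ 2 - z ^ 2))) ∂noiseLaw snr =
      ENNReal.ofReal (Real.exp (-(snr / 8) * c ^ 2)) := by
  have h1 : ∀ z : ℝ, Real.exp (-(snr / 4) * ((z + c) ^ 2 - z ^ 2)) =
      Real.exp (-(snr / 4) * c ^ 2) * Real.exp (-(snr / 2 * c) * z) := by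
    intro z; rw [← Real.exp_add]; congr 1; ring
  have hi := (integrable_exp_mul_gaussianReal (μ := 0) (v := (1 / snr).toNNReal)
    (-(snr / 2 * c))).const_mul (Real.exp (-(snr / 4) * c ^ 2))
  simp_rw [h1]
  rw [noiseLaw, ← ofReal_integral_eq_lintegral_ofReal hi
    (Filter.Eventually.of_forall fun z => by positivity), integral_const_mul]
  have h2 := mgf_gaussianReal (p := gaussianReal 0 (1 / snr).toNNReal) (X := id)
    Measure.map_id (-(snr / 2 * c))
  simp only [mgf, id] at h2
  rw [h2, ← Real.exp_add, Real.coe_toNNReal _ (by positivity)]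
  congr 2
  field_simp; ring

lemma meanRatio_nonneg {snr : ℝ} {s : ℝ → ℝ} (hs : ∀ x, 0 < s x) (Δ : ℝ) :
    0 ≤ meanRatio snr s Δ :=
  integral_nonneg fun _ => (div_pos (hs _) (hs _)).le

lemma integrable_ratio {snr : ℝ} {s : ℝ → ℝ} (hm : Measurable s) {c C : ℝ} (hc : 0 < c)
    (hcs : ∀ x, c ≤ s x) (hsC : ∀ x, s x ≤ C) (Δ : ℝ) :
    Integrable (fun z => s (z + Δ) / s z) (noiseLaw snr) := by
  refine Integrable.of_bound (C := C / c)
    ((hm.comp (measurable_add_const Δ)).div hm).aestronglyMeasurable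
    (Filter.Eventually.of_forall fun z => ?_)
  have h1 := hc.trans_le (hcs z)
  have h2 := hc.trans_le (hcs (z + Δ))
  rw [Real.norm_of_nonneg (by positivity)]
  exact div_le_div₀ (h2.le.trans (hsC _)) (hsC _) hc (hcs z)

lemma measurable_distScore (snr : ℝ) : Measurable (distScore snr) := by
  have := measurable_star
  unfold distScore
  fun_prop

lemma distScore_pos (snr x : ℝ) : 0 < distScore snr x := Real.exp_pos _

lemma distScore_le_one {snr : ℝ} (hsnr : 0 < snr) (x : ℝ) : distScore snr x ≤ 1 :=
  Real.exp_le_one_iff.2 (by nlinarith [sq_nonneg (star x)])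

lemma le_distScore {snr : ℝ} (hsnr : 0 < snr) (x : ℝ) :
    Real.exp (-(snr / 4) * 3) ≤ distScore snr x := by
  have h1 : star x ^ 2 ≤ (L / 2) ^ 2 := by
    rw [← sq_abs (star x)]
    exact pow_le_pow_left₀ (abs_nonneg _) (abs_star_le x) 2
  have h2 : (L / 2) ^ 2 = 3 := by rw [div_pow, L_sq]; norm_num
  exact Real.exp_le_exp.2 (by nlinarith)

lemma distScore_add_int_mul (snr x : ℝ) (k : ℤ) : distScore snr (x + k * L) = distScore snr x := by
  rw [distScore, star_add_int_mul, distScore]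

/-- In the numerator the reduced point is one of the translates by multiples of L, so the sum over
all translates dominates it. In the denominator, reduction only decreases the square. The constant 3
snr/2 is L²·snr/8. -/
lemma ofReal_meanRatio_distScore_le {snr : ℝ} (hsnr : 0 < snr) (u : ℝ) :
    ENNReal.ofReal (meanRatio snr (distScore snr) (L * u)) ≤
      ∑' k : ℤ, ENNReal.ofReal (Real.exp (-(3 * snr / 2) * (u + k) ^ 2)) := by
  have hi := integrable_ratio (snr := snr) (measurable_distScore snr) (Real.exp_pos _)
    (le_distScore hsnr) (distScore_le_one hsnr) (L * u)
  rw [meanRatio, ofReal_integral_eq_lintegral_ofReal hi (Filter.Eventually.of_forall fun z =>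
    (div_pos (distScore_pos _ _) (distScore_pos _ _)).le)]
  have hk : ∀ k : ℤ, ENNReal.ofReal (Real.exp (-(3 * snr / 2) * (u + k) ^ 2)) =
      ∫⁻ z, ENNReal.ofReal (Real.exp (-(snr / 4) * ((z + L * (u + k)) ^ 2 - z ^ 2)))
        ∂noiseLaw snr := by
    intro k
    rw [lintegral_exp_shift hsnr, mul_pow, L_sq]
    congr 2; ring
  simp_rw [hk]
  rw [← lintegral_tsum fun k => by fun_prop]
  refine lintegral_mono fun z => ?_
  obtain ⟨k, hk⟩ := exists_star_eq (z + L * u)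
  refine le_trans ?_ (ENNReal.le_tsum k)
  refine ENNReal.ofReal_le_ofReal ?_
  rw [distScore, distScore, ← Real.exp_sub, hk]
  refine Real.exp_le_exp.2 ?_
  have := star_sq_le z
  have e : z + L * u + k * L = z + L * (u + k) := by ring
  rw [e]
  nlinarith

/-- The sum of mean ratios over points that are `h`-separated on the circle `ℝ / ℤ` and at distance
at least `e` from `0`. -/
lemma sum_meanRatio_le {ι : Type*} {snr : ℝ} (hsnr : 0 < snr) (s : Finset ι) (u : ι → ℝ) {h e : ℝ}
    (hh : 0 < h) (hh1 : h ≤ 1) (he : 0 ≤ e)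
    (hsep : ∀ i ∈ s, ∀ j ∈ s, i ≠ j → ∀ k : ℤ, h ≤ |u i - u j + k|)
    (hmin : ∀ i ∈ s, ∀ k : ℤ, e ≤ |u i + k|) :
    ∑ i ∈ s, meanRatio snr (distScore snr) (L * u i) ≤
      Real.exp (-(3 * snr / 2) * e ^ 2) + √((2 * Real.pi / 3) / snr) / h := by
  have h0 : √((2 * Real.pi / 3) / snr) = √(Real.pi / (3 * snr / 2)) := by
    congr 1; field_simp
  rw [← ENNReal.ofReal_le_ofReal_iff (by positivity),
    ENNReal.ofReal_sum_of_nonneg fun _ _ => meanRatio_nonneg (distScore_pos snr) _, h0]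
  exact (Finset.sum_le_sum fun i _ => ofReal_meanRatio_distScore_le hsnr (u i)).trans
    (sum_tsum_exp_le_of_separated s u hh hh1 (by positivity) he hsep hmin)

end

end LinearMAC

/-! ### The circular-mean test for pairs in the span. -/

namespace LinearMAC

noncomputable section

/-- The score of the circular-mean test with parameter `lam`. -/
def cosScore (lam x : ℝ) : ℝ := Real.exp (lam * Real.cos (2 * Real.pi / L * x))

lemma cosScore_pos (lam x : ℝ) : 0 < cosScore lam x := Real.exp_pos _

lemma measurable_cosScore (lam : ℝ) : Measurable (cosScore lam) := by
  unfold cosScore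
  fun_prop

lemma cosScore_le {lam : ℝ} (h : 0 ≤ lam) (x : ℝ) : cosScore lam x ≤ Real.exp lam :=
  Real.exp_le_exp.2 (mul_le_of_le_one_right h (Real.cos_le_one _))

lemma le_cosScore {lam : ℝ} (h : 0 ≤ lam) (x : ℝ) : Real.exp (-lam) ≤ cosScore lam x :=
  Real.exp_le_exp.2 (by nlinarith [Real.neg_one_le_cos (2 * Real.pi / L * x)])

lemma cosScore_add_int_mul (lam x : ℝ) (k : ℤ) : cosScore lam (x + k * L) = cosScore lam x := by
  have hL := L_pos.ne'
  have : 2 * Real.pi / L * (x + k * L) = 2 * Real.pi / L * x + k * (2 * Real.pi) := by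
    field_simp
  rw [cosScore, this, Real.cos_add_int_mul_two_pi, cosScore]

/-- This is the real part of the Gaussian characteristic function, rotated by the phase θc. -/
lemma integral_cos_noiseLaw {snr : ℝ} (hsnr : 0 < snr) (θ c : ℝ) :
    ∫ z, Real.cos (θ * (z + c)) ∂noiseLaw snr =
      Real.exp (-(θ ^ 2 / (2 * snr))) * Real.cos (θ * c) := by
  have h1 := charFun_gaussianReal (μ := 0) (v := (1 / snr).toNNReal) θ
  rw [charFun_apply_real] at h1
  have hint : Integrable (fun z : ℝ => Complex.exp (θ * z * Complex.I)) (noiseLaw snr) := by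
    refine Integrable.of_bound (C := 1) (by fun_prop) (Filter.Eventually.of_forall fun z => ?_)
    have : (θ : ℂ) * z * Complex.I = ((θ * z : ℝ) : ℂ) * Complex.I := by push_cast; ring
    rw [this, Complex.norm_exp_ofReal_mul_I]
  have h2 : ∀ z : ℝ, Real.cos (θ * (z + c)) =
      RCLike.re (Complex.exp (θ * c * Complex.I) * Complex.exp (θ * z * Complex.I)) := by
    intro z
    rw [← Complex.exp_add]
    have : (θ : ℂ) * c * Complex.I + θ * z * Complex.I =
      ((θ * (z + c) : ℝ) : ℂ) * Complex.I := by push_cast; ring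
    rw [this]
    exact (Complex.exp_ofReal_mul_I_re _).symm
  simp_rw [h2]
  rw [integral_re (hint.const_mul _), integral_const_mul, noiseLaw, h1]
  have h3 : (θ : ℂ) * (0 : ℝ) * Complex.I - ((1 / snr).toNNReal : ℝ) * (θ : ℂ) ^ 2 / 2 =
      ((-(θ ^ 2 / (2 * snr)) : ℝ) : ℂ) := by
    rw [Real.coe_toNNReal _ (by positivity)]
    push_cast
    have : (snr : ℂ) ≠ 0 := by exact_mod_cast hsnr.ne'
    field_simp; ring
  rw [h3, ← Complex.ofReal_exp, mul_comm]
  have h4 : (θ : ℂ) * c * Complex.I = ((θ * c : ℝ) : ℂ) * Complex.I := by push_cast; ring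
  rw [h4]
  show (((Real.exp _ : ℝ) : ℂ) * _).re = _
  rw [Complex.re_ofReal_mul, Complex.exp_ofReal_mul_I_re]

/-- Expand to first order in `lam`: the linear term has negative mean unless the shift is a multiple
of L, and exp x ≤ 1 + x + x² for |x| ≤ 1 controls the rest, the difference of cosines being at most
2 in absolute value. -/
lemma meanRatio_cosScore_le {snr : ℝ} (hsnr : 0 < snr) {lam : ℝ} (h0 : 0 ≤ lam)
    (h1 : lam ≤ 1 / 2) (Δ : ℝ) :
    meanRatio snr (cosScore lam) Δ ≤
      1 - lam * (Real.exp (-((2 * Real.pi / L) ^ 2 / (2 * snr))) *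
        (1 - Real.cos (2 * Real.pi / L * Δ))) + 4 * lam ^ 2 := by
  set θ := 2 * Real.pi / L
  have hic : ∀ c, Integrable (fun z : ℝ => Real.cos (θ * (z + c))) (noiseLaw snr) := by
    intro c
    refine Integrable.of_bound (C := 1) (by fun_prop) (Filter.Eventually.of_forall fun z => ?_)
    exact Real.abs_cos_le_one _
  have hic0 : Integrable (fun z : ℝ => Real.cos (θ * z)) (noiseLaw snr) := by simpa using hic 0
  have hc0 := integral_cos_noiseLaw hsnr θ 0
  simp only [add_zero, mul_zero, Real.cos_zero, mul_one] at hc0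
  calc meanRatio snr (cosScore lam) Δ
      ≤ ∫ z, (1 + 4 * lam ^ 2 + lam * (Real.cos (θ * (z + Δ)) - Real.cos (θ * z)))
          ∂noiseLaw snr := by
        refine integral_mono (integrable_ratio (measurable_cosScore lam) (Real.exp_pos _)
          (le_cosScore h0) (cosScore_le h0) Δ)
          ((integrable_const _).add (((hic Δ).sub hic0).const_mul lam)) fun z => ?_
        show cosScore lam (z + Δ) / cosScore lam z ≤ _
        rw [cosScore, cosScore, ← Real.exp_sub, ← mul_sub]
        set d := Real.cos (θ * (z + Δ)) - Real.cos (θ * z)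
        have hd : |d| ≤ 2 := by
          rw [abs_le]
          constructor <;> linarith [Real.cos_le_one (θ * (z + Δ)), Real.cos_le_one (θ * z),
            Real.neg_one_le_cos (θ * (z + Δ)), Real.neg_one_le_cos (θ * z)]
        have hld : |lam * d| ≤ 1 := by
          rw [abs_mul, abs_of_nonneg h0]
          nlinarith [abs_nonneg d]
        have h2 := (abs_le.1 (Real.abs_exp_sub_one_sub_id_le hld)).2
        have h3 : d ^ 2 ≤ 4 := by nlinarith [sq_abs d, abs_nonneg d]
        have h4 : (lam * d) ^ 2 ≤ 4 * lam ^ 2 := by rw [mul_pow]; nlinarith [sq_nonneg lam]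
        show Real.exp (lam * d) ≤ 1 + 4 * lam ^ 2 + lam * d
        linarith
    _ = _ := by
        have hsub : Integrable (fun z : ℝ => lam * (Real.cos (θ * (z + Δ)) - Real.cos (θ * z)))
            (noiseLaw snr) := ((hic Δ).sub hic0).const_mul lam
        rw [integral_add (integrable_const _) hsub,
          integral_const_mul, integral_sub (hic Δ) hic0, integral_cos_noiseLaw hsnr, hc0]
        simp
        ring

/-- If every member of a finite family of shift patterns moves some coordinate off the lattice,
the circular-mean test has, for a suitable parameter, average ratio uniformly below `1`. -/
lemma exists_cosScore_contracting {snr : ℝ} (hsnr : 0 < snr) {τ ι : Type*} [Finite τ] [Fintype ι]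
    (D : τ → ι → ℝ) (hD : ∀ T, ∃ i, ∀ k : ℤ, D T i ≠ k * L) :
    ∃ lam θ : ℝ, 0 ≤ lam ∧ 0 ≤ θ ∧ θ < 1 ∧
      ∀ T, ∑ i, meanRatio snr (cosScore lam) (D T i) ≤ θ * Fintype.card ι := by
  rcases isEmpty_or_nonempty τ with hτ | hτ
  · exact ⟨0, 0, le_rfl, le_rfl, one_pos, fun T => hτ.elim T⟩
  have hL := L_pos.ne'
  let gap : τ → ℝ := fun T => ∑ i, Real.exp (-((2 * Real.pi / L) ^ 2 / (2 * snr))) *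
        (1 - Real.cos (2 * Real.pi / L * D T i))
  have hgap : ∀ T, 0 < gap T := by
    intro T
    obtain ⟨i, hi⟩ := hD T
    refine Finset.sum_pos' (fun i _ => mul_nonneg (Real.exp_pos _).le
      (sub_nonneg.2 (Real.cos_le_one _))) ⟨i, Finset.mem_univ _, mul_pos (Real.exp_pos _) ?_⟩
    refine sub_pos.2 (lt_of_le_of_ne (Real.cos_le_one _) fun h => ?_)
    obtain ⟨k, hk⟩ := (Real.cos_eq_one_iff _).1 h
    refine hi k ?_
    have hpi := Real.pi_pos.ne'
    field_simp at hk
    linarith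
  obtain ⟨T₀, hT₀⟩ := Finite.exists_min gap
  have hcard : (0 : ℝ) < Fintype.card ι := by
    obtain ⟨i, -⟩ := hD T₀
    exact_mod_cast Fintype.card_pos_iff.2 ⟨i⟩
  set N : ℝ := (Fintype.card ι : ℝ)
  set c := gap T₀
  have hc : 0 < c := hgap T₀
  -- Chosen so that the quadratic loss 4·lam²·N is at most half of the linear gain lam·c, where c is
  -- the smallest gap over the finite family.
  set lam := min (1 / 2) (c / (8 * N))
  have hl0 : 0 < lam := lt_min (by norm_num) (by positivity)
  have hl1 : lam ≤ 1 / 2 := min_le_left _ _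
  have hl2 : lam * (8 * N) ≤ c := (le_div_iff₀ (by positivity)).1 (min_le_right _ _)
  have hsum : ∀ T, ∑ i, meanRatio snr (cosScore lam) (D T i) ≤ (1 - lam * c / (2 * N)) * N := by
    intro T
    calc ∑ i, meanRatio snr (cosScore lam) (D T i)
        ≤ ∑ i, (1 - lam * (Real.exp (-((2 * Real.pi / L) ^ 2 / (2 * snr))) *
            (1 - Real.cos (2 * Real.pi / L * D T i))) + 4 * lam ^ 2) :=
          Finset.sum_le_sum fun i _ => meanRatio_cosScore_le hsnr hl0.le hl1 _
      _ = N - lam * gap T + 4 * lam ^ 2 * N := by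
          rw [Finset.sum_add_distrib, Finset.sum_sub_distrib, ← Finset.mul_sum]
          simp [N, gap]; ring
      _ ≤ N - lam * c + lam * c / 2 := by nlinarith [hT₀ T]
      _ = _ := by field_simp; ring
  refine ⟨lam, 1 - lam * c / (2 * N), hl0.le, ?_, ?_, hsum⟩
  · have h1 := hsum T₀
    have h2 : 0 ≤ ∑ i, meanRatio snr (cosScore lam) (D T₀ i) :=
      Finset.sum_nonneg fun i _ => meanRatio_nonneg (cosScore_pos lam) _
    by_contra hn
    push Not at hn
    nlinarith [mul_neg_of_neg_of_pos hn hcard]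
  · have : 0 < lam * c / (2 * N) := by positivity
    linarith

end

end LinearMAC

/-! ### Decoding by pairwise comparisons. -/

namespace LinearMAC

noncomputable section

lemma measureReal_noise_one_le_prod_le {n : ℕ} {snr : ℝ} {s : ℝ → ℝ} (hm : Measurable s) {c C : ℝ}
    (hc : 0 < c) (hcs : ∀ x, c ≤ s x) (hsC : ∀ x, s x ≤ C) (Δ : Fin n → ℝ) :
    (noise n snr).real {z | 1 ≤ ∏ t, s (z t + Δ t) / s (z t)} ≤ ∏ t, meanRatio snr s (Δ t) := by
  have hint : Integrable (fun z : Fin n → ℝ => ∏ t, s (z t + Δ t) / s (z t))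
      (Measure.pi fun _ => noiseLaw snr) :=
    Integrable.fintype_prod (f := fun t z => s (z + Δ t) / s z)
      fun t => integrable_ratio hm hc hcs hsC (Δ t)
  have hpos : ∀ x, 0 < s x := fun x => hc.trans_le (hcs x)
  have h := mul_meas_ge_le_integral_of_nonneg (Filter.Eventually.of_forall fun z =>
    Finset.prod_nonneg fun t _ => (div_pos (hpos (z t + Δ t)) (hpos (z t))).le) hint 1
  rw [one_mul, integral_fintype_prod_eq_prod (fun t z => s (z + Δ t) / s z)] at h
  exact h

/-- A decoder that decides by pairwise comparisons of product scores; the scoring function may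
depend on the pair of hypotheses that is compared. -/
theorem exists_decoder {n : ℕ} {W : Type*} [Fintype W] [DecidableEq W] [Nonempty W] (snr : ℝ)
    (m : W → Fin n → ℝ) (s : W → W → ℝ → ℝ) (hsymm : ∀ w w', s w w' = s w' w)
    (hmeas : ∀ w w', Measurable (s w w'))
    (hper : ∀ w w' x, ∀ k : ℤ, s w w' (x + k * L) = s w w' x)
    (hbd : ∀ w w', ∃ c C : ℝ, 0 < c ∧ (∀ x, c ≤ s w w' x) ∧ ∀ x, s w w' x ≤ C) :
    ∃ dec : (Fin n → ℝ) → W, (∀ w, MeasurableSet (dec ⁻¹' {w})) ∧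
      ∀ w, (noise n snr).real {z | dec (fun t => star (m w t + z t)) ≠ w} ≤
        ∑ w' ∈ Finset.univ.erase w, ∏ t, meanRatio snr (s w w') (m w t - m w' t) := by
  classical
  let score : W → W → (Fin n → ℝ) → ℝ := fun w w' y => ∏ t, s w w' (y t - m w t)
  -- A winner strictly beats every rival, so there is at most one. Ties count as errors, and without
  -- a winner the decoder outputs a fixed default.
  let win : W → (Fin n → ℝ) → Prop := fun w y => ∀ w', w' ≠ w → score w' w y < score w w' y
  have hscore : ∀ w w', Measurable (score w w') := fun w w' =>
    Finset.measurable_prod _ fun t _ =>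
      (hmeas w w').comp ((measurable_pi_apply t).sub_const _)
  have hwin : ∀ w, MeasurableSet {y | win w y} := by
    intro w
    simp only [win, Set.ofPred_forall]
    exact MeasurableSet.iInter fun w' => MeasurableSet.iInter fun _ =>
      measurableSet_lt (hscore _ _) (hscore _ _)
  have huniq : ∀ {w w' y}, win w y → win w' y → w = w' := by
    intro w w' y h1 h2
    by_contra hne
    exact lt_asymm (h1 w' (Ne.symm hne)) (h2 w hne)
  let dec : (Fin n → ℝ) → W := fun y =>
    if h : ∃ w, win w y then h.choose else Classical.arbitrary W
  have hdec : ∀ {w y}, win w y → dec y = w := by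
    intro w y h
    have he : ∃ w, win w y := ⟨w, h⟩
    simp only [dec, dif_pos he]
    exact huniq he.choose_spec h
  refine ⟨dec, fun w => ?_, fun w => ?_⟩
  · have : dec ⁻¹' {w} = {y | win w y} ∪
        ((⋃ w', {y | win w' y})ᶜ ∩ {_y | w = Classical.arbitrary W}) := by
      ext y
      simp only [Set.mem_preimage, Set.mem_singleton_iff, Set.mem_union, Set.mem_ofPred_eq,
        Set.mem_inter_iff, Set.mem_compl_iff, Set.mem_iUnion]
      constructor
      · intro h
        by_cases he : ∃ w, win w y
        · obtain ⟨w', hw'⟩ := he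
          left; rw [← h, hdec hw']; exact hw'
        · right
          refine ⟨he, ?_⟩
          rw [← h]; simp only [dec, dif_neg he]
      · rintro (h | ⟨he, h⟩)
        · exact hdec h
        · rw [h]; simp only [dec, dif_neg he]
    rw [this]
    exact (hwin w).union ((MeasurableSet.iUnion hwin).compl.inter (MeasurableSet.const _))
  · have hsub : {z : Fin n → ℝ | dec (fun t => star (m w t + z t)) ≠ w} ⊆
        ⋃ w' ∈ Finset.univ.erase w,
          {z | 1 ≤ ∏ t, s w w' (z t + (m w t - m w' t)) / s w w' (z t)} := by
      intro z hz
      have hnw : ¬ win w (fun t => star (m w t + z t)) := fun h => hz (hdec h)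
      simp only [win, not_forall, not_lt] at hnw
      obtain ⟨w', hw', hle⟩ := hnw
      simp only [Set.mem_iUnion]
      refine ⟨w', Finset.mem_erase.2 ⟨hw', Finset.mem_univ _⟩, ?_⟩
      obtain ⟨c, C, hc, hcs, -⟩ := hbd w w'
      have hpos : ∀ x, 0 < s w w' x := fun x => hc.trans_le (hcs x)
      -- Periodicity removes the reduction: relative to either hypothesis the received point is the
      -- noise plus a shift, up to a multiple of L.
      have hshift : ∀ a b t, s w w' (star (a + z t) - b) = s w w' (z t + (a - b)) := by
        intro a b t
        obtain ⟨k, hk⟩ := exists_star_eq (a + z t)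
        rw [hk, ← hper w w' (z t + (a - b)) k]
        congr 1; ring
      simp only [score, hsymm w' w, hshift, sub_self, add_zero] at hle
      rw [Set.mem_ofPred_eq, Finset.prod_div_distrib]
      rwa [one_le_div (Finset.prod_pos fun t _ => hpos _)]
    have : IsProbabilityMeasure (noise n snr) := by unfold noise; infer_instance
    refine (measureReal_mono hsub (measure_ne_top _ _)).trans
      ((measureReal_biUnion_finset_le _ _).trans (Finset.sum_le_sum fun w' _ => ?_))
    obtain ⟨c, C, hc, hcs, hsC⟩ := hbd w w'
    exact measureReal_noise_one_le_prod_le (hmeas w w') hc hcs hsC _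

end

end LinearMAC

/-! ### Random linear codes: averaging over a generator column and counting pairs. -/

namespace LinearMAC

noncomputable section

section Averaging

/-- Translations preserve the uniform law on the group, so a bound on the average over the shifts σ
at every base point bounds the full average. -/
lemma sum_le_of_sum_shift_le {V S : Type*} [AddGroup V] [Fintype V] [Fintype S] [Nonempty S]
    (F : V → ℝ) (σ : S → V) {B : ℝ} (h : ∀ g, ∑ s, F (g + σ s) ≤ Fintype.card S * B) :
    ∑ g, F g ≤ Fintype.card V * B := by
  have hS : (0 : ℝ) < Fintype.card S := by exact_mod_cast Fintype.card_pos
  have h1 : ∑ g, ∑ s, F (g + σ s) = Fintype.card S * ∑ g, F g := by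
    have hs : ∀ s, ∑ g, F (g + σ s) = ∑ g, F g := fun s => Equiv.sum_comp (Equiv.addRight (σ s)) F
    rw [Finset.sum_comm, Finset.sum_congr rfl fun s _ => hs s]
    simp
  have h2 : ∑ g, ∑ s, F (g + σ s) ≤ Fintype.card V * (Fintype.card S * B) := by
    refine (Finset.sum_le_sum fun g _ => h g).trans_eq ?_
    simp
  rw [h1] at h2
  refine le_of_mul_le_mul_left ?_ hS
  linarith

lemma exists_dotProduct_ne_zero {K ι : Type*} [Field K] [Fintype ι] {p : Submodule K (ι → K)}
    {v : ι → K} (hv : v ∉ p) : ∃ h : ι → K, h ⬝ᵥ v ≠ 0 ∧ ∀ u ∈ p, h ⬝ᵥ u = 0 := by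
  classical
  obtain ⟨f, hfv, hf⟩ := Submodule.exists_le_ker_of_notMem hv
  have key : ∀ u, (fun i => f fun j => if i = j then 1 else 0) ⬝ᵥ u = f u := by
    intro u
    rw [LinearMap.pi_apply_eq_sum_univ f u, dotProduct]
    exact Finset.sum_congr rfl fun i _ => by rw [smul_eq_mul, mul_comm]
  exact ⟨_, by rwa [key], fun u hu => by rw [key]; exact hf hu⟩

variable {K : Type*} [Field K] [Fintype K]

lemma sum_affine_comp (f : K → ℝ) (a : K) {c : K} (hc : c ≠ 0) :
    ∑ s, f (a + s * c) = ∑ s, f s :=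
  Equiv.sum_comp ((Equiv.mulRight₀ c hc).trans (Equiv.addLeft a)) f

/-- An affine map of the plane with triangular linear part and nonzero diagonal is a bijection. -/
lemma sum_triangular_comp (f : K → K → ℝ) (a b e : K) {c d : K} (hc : c ≠ 0) (hd : d ≠ 0) :
    ∑ x : K × K, f (a + (x.1 * c + x.2 * e)) (b + x.2 * d) = ∑ x : K × K, f x.1 x.2 := by
  rw [Fintype.sum_prod_type_right, Fintype.sum_prod_type_right]
  rw [← sum_affine_comp (fun t => ∑ s, f s t) b hd]
  refine Finset.sum_congr rfl fun t _ => ?_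
  show ∑ s, f (a + (s * c + t * e)) (b + t * d) = _
  rw [← sum_affine_comp (fun s => f s (b + t * d)) (a + t * e) hc]
  refine Finset.sum_congr rfl fun s _ => ?_
  congr 1; ring

end Averaging

section Pairs

variable {K V : Type*} [Field K] [AddCommGroup V] [Module K V]

/-- Both components of `w'` are linear combinations of the components of `w`. -/
def InSpan (K : Type*) {V : Type*} [Field K] [AddCommGroup V] [Module K V] (w w' : V × V) : Prop :=
  ∃ a b c d : K, w'.1 = a • w.1 + b • w.2 ∧ w'.2 = c • w.1 + d • w.2

/-- Together with the components of `w`, those of `w'` add at most one dimension. -/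
def AlmostInSpan (K : Type*) {V : Type*} [Field K] [AddCommGroup V] [Module K V]
    (w w' : V × V) : Prop :=
  (∃ a b : K, w'.1 = a • w.1 + b • w.2) ∨ ∃ a b c : K, w'.2 = a • w.1 + b • w.2 + c • w'.1

/-- The two components are linearly independent. -/
def IndepPair (K : Type*) {V : Type*} [Field K] [AddCommGroup V] [Module K V] (w : V × V) : Prop :=
  w.2 ≠ 0 ∧ ∀ c : K, w.1 ≠ c • w.2

lemma IndepPair.eq_zero {w : V × V} (hw : IndepPair K w) {a b : K}
    (h : a • w.1 = b • w.2) : a = 0 ∧ b = 0 := by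
  have ha : a = 0 := by
    by_contra ha
    refine hw.2 (a⁻¹ * b) ?_
    rw [mul_smul, ← h, smul_smul, inv_mul_cancel₀ ha, one_smul]
  refine ⟨ha, ?_⟩
  rw [ha, zero_smul] at h
  exact (smul_eq_zero.1 h.symm).resolve_right hw.1

/-- Cramer's rule: independence of w forces a nonzero determinant. Since the scores must be
symmetric in the two hypotheses, `pairScore` tests both directions of `InSpan`; for independent w
the second adds nothing. -/
lemma IndepPair.inSpan_of_inSpan {w w' : V × V} (hw : IndepPair K w) (h : InSpan K w' w) :
    InSpan K w w' := by
  obtain ⟨a, b, c, d, h1, h2⟩ := h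
  set D := a * d - b * c with hD
  have e1 : D • w'.1 = d • w.1 - b • w.2 := by rw [h1, h2, hD]; module
  have e2 : D • w'.2 = a • w.2 - c • w.1 := by rw [h1, h2, hD]; module
  by_cases hD0 : D = 0
  · rw [hD0, zero_smul] at e1 e2
    obtain ⟨-, hb⟩ := hw.eq_zero (sub_eq_zero.1 e1.symm)
    obtain ⟨-, ha⟩ := hw.eq_zero (sub_eq_zero.1 e2.symm).symm
    exact absurd (by rw [h1, ha, hb]; simp) (hw.2 0)
  · refine ⟨D⁻¹ * d, -(D⁻¹ * b), -(D⁻¹ * c), D⁻¹ * a, ?_, ?_⟩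
    · rw [← one_smul K w'.1, ← inv_mul_cancel₀ hD0, mul_smul, e1]; module
    · rw [← one_smul K w'.2, ← inv_mul_cancel₀ hD0, mul_smul, e2]; module

variable [Fintype K] [Fintype V]

open Classical in
lemma card_not_indepPair_le :
    (Finset.univ.filter fun w : V × V => ¬ IndepPair K w).card ≤
      (Fintype.card K + 1) * Fintype.card V := by
  have hsub : (Finset.univ.filter fun w : V × V => ¬ IndepPair K w) ⊆
      (Finset.univ.image fun v : V => (v, (0 : V))) ∪
        (Finset.univ.image fun x : K × V => (x.1 • x.2, x.2)) := by
    rintro ⟨w1, w2⟩ hw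
    simp only [Finset.mem_filter, Finset.mem_univ, true_and, IndepPair, not_and_or, not_not,
      not_forall] at hw
    simp only [Finset.mem_union, Finset.mem_image, Finset.mem_univ, true_and, Prod.mk.injEq]
    rcases hw with rfl | ⟨c, rfl⟩
    · exact Or.inl ⟨w1, rfl, rfl⟩
    · exact Or.inr ⟨(c, w2), rfl, rfl⟩
  refine (Finset.card_le_card hsub).trans ((Finset.card_union_le _ _).trans ?_)
  refine (add_le_add Finset.card_image_le Finset.card_image_le).trans_eq ?_
  simp only [Finset.card_univ, Fintype.card_prod]
  ring

open Classical in
lemma card_inSpan_le (w : V × V) :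
    (Finset.univ.filter fun w' : V × V => InSpan K w w').card ≤ Fintype.card K ^ 4 := by
  have hsub : (Finset.univ.filter fun w' : V × V => InSpan K w w') ⊆
      Finset.univ.image fun x : K × K × K × K =>
        (x.1 • w.1 + x.2.1 • w.2, x.2.2.1 • w.1 + x.2.2.2 • w.2) := by
    rintro ⟨w1, w2⟩ hw
    obtain ⟨a, b, c, d, h1, h2⟩ := (Finset.mem_filter.1 hw).2
    exact Finset.mem_image.2 ⟨(a, b, c, d), Finset.mem_univ _, Prod.ext h1.symm h2.symm⟩
  refine (Finset.card_le_card hsub).trans (Finset.card_image_le.trans_eq ?_)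
  simp only [Finset.card_univ, Fintype.card_prod]
  ring

open Classical in
lemma card_almostInSpan_le (w : V × V) :
    (Finset.univ.filter fun w' : V × V => AlmostInSpan K w w').card ≤
      (Fintype.card K ^ 2 + Fintype.card K ^ 3) * Fintype.card V := by
  have hsub : (Finset.univ.filter fun w' : V × V => AlmostInSpan K w w') ⊆
      (Finset.univ.image fun x : K × K × V => (x.1 • w.1 + x.2.1 • w.2, x.2.2)) ∪
      Finset.univ.image fun x : K × K × K × V =>
        (x.2.2.2, x.1 • w.1 + x.2.1 • w.2 + x.2.2.1 • x.2.2.2) := by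
    rintro ⟨w1, w2⟩ hw
    simp only [Finset.mem_union, Finset.mem_image, Finset.mem_univ, true_and, Prod.mk.injEq]
    rcases (Finset.mem_filter.1 hw).2 with ⟨a, b, h⟩ | ⟨a, b, c, h⟩
    · exact Or.inl ⟨(a, b, w2), h.symm, rfl⟩
    · exact Or.inr ⟨(a, b, c, w1), rfl, h.symm⟩
  refine (Finset.card_le_card hsub).trans ((Finset.card_union_le _ _).trans ?_)
  refine (add_le_add Finset.card_image_le Finset.card_image_le).trans_eq ?_
  simp only [Finset.card_univ, Fintype.card_prod]
  ring

end Pairs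

/-- The point of the centred `q`-point constellation with label `a`. -/
def constellation {q : ℕ} (a : ZMod q) : ℝ := L / q * a.valMinAbs

/-- The noiseless contribution of the symbols with labels `a` and `b`. -/
def superposition {q : ℕ} (γ : ℝ) (a b : ZMod q) : ℝ := constellation a + γ * constellation b

/-- Single-letter conditions under which random linear codes over `ZMod q` are decoded. The
constants `A` and `B` bound the mean ratios averaged over the plane and over lines. -/
structure GoodConstellation (γ snr : ℝ) (q : ℕ) [NeZero q] (A B : ℝ) : Prop where
  plane : ∀ a b : ZMod q, ∑ x : ZMod q × ZMod q,
    meanRatio snr (distScore snr) (superposition γ a b - superposition γ x.1 x.2) ≤ (q : ℝ) ^ 2 * A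
  line : ∀ (m : ℝ) (a b c d : ZMod q), (c ≠ 0 ∨ d ≠ 0) → ∑ s : ZMod q,
    meanRatio snr (distScore snr) (m - superposition γ (a + s * c) (b + s * d)) ≤ q * B
  distinct : ∀ T : ZMod q × ZMod q × ZMod q × ZMod q, T ≠ (1, 0, 0, 1) →
    ∃ a b : ZMod q, ∀ k : ℤ, superposition γ a b -
      superposition γ (T.1 * a + T.2.1 * b) (T.2.2.1 * a + T.2.2.2 * b) ≠ k * L

section RandomCode

variable {γ snr : ℝ} {q : ℕ} [Fact q.Prime] {ι : Type*} [Fintype ι]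

/-- The noiseless channel output when the messages `w` are encoded with the generator column
`g`. -/
def columnOutput (γ : ℝ) (g : ι → ZMod q) (w : (ι → ZMod q) × (ι → ZMod q)) : ℝ :=
  superposition γ (g ⬝ᵥ w.1) (g ⬝ᵥ w.2)

lemma sum_column_inSpan_le [DecidableEq ι] {w w' : (ι → ZMod q) × (ι → ZMod q)} {lam θ : ℝ}
    (hθ : ∀ T : ZMod q × ZMod q × ZMod q × ZMod q, T ≠ (1, 0, 0, 1) →
      ∑ x : ZMod q × ZMod q, meanRatio snr (cosScore lam) (superposition γ x.1 x.2 -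
        superposition γ (T.1 * x.1 + T.2.1 * x.2) (T.2.2.1 * x.1 + T.2.2.2 * x.2)) ≤
          (q : ℝ) ^ 2 * θ)
    (hw : IndepPair (ZMod q) w) (hne : w' ≠ w) (hs : InSpan (ZMod q) w w') :
    ∑ g, meanRatio snr (cosScore lam) (columnOutput γ g w - columnOutput γ g w') ≤
      Fintype.card (ι → ZMod q) * θ := by
  obtain ⟨a, b, c, d, e1, e2⟩ := hs
  have hT : (a, b, c, d) ≠ ((1, 0, 0, 1) : ZMod q × ZMod q × ZMod q × ZMod q) := by
    rintro h
    simp only [Prod.mk.injEq] at h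
    obtain ⟨rfl, rfl, rfl, rfl⟩ := h
    exact hne (Prod.ext (by simpa using e1) (by simpa using e2))
  have h1 : w.1 ∉ Submodule.span (ZMod q) {w.2} := by
    rw [Submodule.mem_span_singleton]
    rintro ⟨y, hy⟩
    exact hw.2 y hy.symm
  -- Shifting the column along h₁ moves only the label of `w.1`; shifting along h₂ moves the label
  -- of `w.2`. Together they sweep the whole plane of labels, while w' remains the fixed linear
  -- image of w.
  obtain ⟨h₁, hc₁, hz₁⟩ := exists_dotProduct_ne_zero h1
  have hz := hz₁ w.2 (Submodule.mem_span_singleton_self _)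
  obtain ⟨h₂, hc₂, -⟩ := exists_dotProduct_ne_zero
    (p := (⊥ : Submodule (ZMod q) (ι → ZMod q))) (v := w.2) (by simpa using hw.1)
  refine sum_le_of_sum_shift_le (S := ZMod q × ZMod q) _ (fun x => x.1 • h₁ + x.2 • h₂) fun g => ?_
  have hq : (Fintype.card (ZMod q × ZMod q) : ℝ) = (q : ℝ) ^ 2 := by
    rw [Fintype.card_prod, ZMod.card]; push_cast; ring
  rw [hq]
  refine le_trans (le_of_eq ?_) (hθ (a, b, c, d) hT)
  rw [← sum_triangular_comp (fun x y => meanRatio snr (cosScore lam) (superposition γ x y -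
        superposition γ (a * x + b * y) (c * x + d * y))) (g ⬝ᵥ w.1) (g ⬝ᵥ w.2) (h₂ ⬝ᵥ w.1) hc₁ hc₂]
  refine Finset.sum_congr rfl fun x _ => ?_
  simp only [columnOutput, e1, e2, dotProduct_add, dotProduct_smul, add_dotProduct,
    smul_dotProduct, smul_eq_mul, hz, mul_zero, zero_add]

lemma sum_column_le_of_not_inSpan [DecidableEq ι] {A B : ℝ} (hG : GoodConstellation γ snr q A B)
    {w w' : (ι → ZMod q) × (ι → ZMod q)} (hs : ¬ InSpan (ZMod q) w w') :
    ∑ g, meanRatio snr (distScore snr) (columnOutput γ g w - columnOutput γ g w') ≤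
      Fintype.card (ι → ZMod q) * B := by
  -- Shifting along such an h fixes the labels of w and moves those of w' along a nondegenerate
  -- line.
  have hex : ∃ h : ι → ZMod q, (h ⬝ᵥ w'.1 ≠ 0 ∨ h ⬝ᵥ w'.2 ≠ 0) ∧ h ⬝ᵥ w.1 = 0 ∧ h ⬝ᵥ w.2 = 0 := by
    have hm1 : w.1 ∈ Submodule.span (ZMod q) {w.1, w.2} := Submodule.subset_span (by simp)
    have hm2 : w.2 ∈ Submodule.span (ZMod q) {w.1, w.2} := Submodule.subset_span (by simp)
    by_cases h1 : w'.1 ∈ Submodule.span (ZMod q) {w.1, w.2}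
    · by_cases h2 : w'.2 ∈ Submodule.span (ZMod q) {w.1, w.2}
      · obtain ⟨a, b, hab⟩ := Submodule.mem_span_pair.1 h1
        obtain ⟨c, d, hcd⟩ := Submodule.mem_span_pair.1 h2
        exact absurd ⟨a, b, c, d, hab.symm, hcd.symm⟩ hs
      · obtain ⟨h, hv, hu⟩ := exists_dotProduct_ne_zero h2
        exact ⟨h, Or.inr hv, hu _ hm1, hu _ hm2⟩
    · obtain ⟨h, hv, hu⟩ := exists_dotProduct_ne_zero h1
      exact ⟨h, Or.inl hv, hu _ hm1, hu _ hm2⟩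
  obtain ⟨h, hne, hz1, hz2⟩ := hex
  refine sum_le_of_sum_shift_le (S := ZMod q) _ (fun s => s • h) fun g => ?_
  rw [ZMod.card]
  refine le_trans (le_of_eq ?_) (hG.line (columnOutput γ g w) (g ⬝ᵥ w'.1) (g ⬝ᵥ w'.2) _ _ hne)
  refine Finset.sum_congr rfl fun s _ => ?_
  simp only [columnOutput, add_dotProduct, smul_dotProduct, smul_eq_mul, hz1, hz2, mul_zero,
    add_zero]

lemma sum_column_le_of_not_almostInSpan [DecidableEq ι] {A B : ℝ}
    (hG : GoodConstellation γ snr q A B)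
    {w w' : (ι → ZMod q) × (ι → ZMod q)} (hs : ¬ AlmostInSpan (ZMod q) w w') :
    ∑ g, meanRatio snr (distScore snr) (columnOutput γ g w - columnOutput γ g w') ≤
      Fintype.card (ι → ZMod q) * A := by
  rw [AlmostInSpan, not_or] at hs
  have h1 : w'.1 ∉ Submodule.span (ZMod q) {w.1, w.2} := by
    intro h
    obtain ⟨a, b, hab⟩ := Submodule.mem_span_pair.1 h
    exact hs.1 ⟨a, b, hab.symm⟩
  have h2 : w'.2 ∉ Submodule.span (ZMod q) {w.1, w.2, w'.1} := by
    intro h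
    obtain ⟨a, b, c, habc⟩ := Submodule.mem_span_triple.1 h
    exact hs.2 ⟨a, b, c, habc.symm⟩
  -- Both functionals annihilate w; h₂ also annihilates `w'.1`. The labels of w' therefore sweep the
  -- plane by a triangular map while those of w stay fixed.
  obtain ⟨h₁, hc₁, hu₁⟩ := exists_dotProduct_ne_zero h1
  obtain ⟨h₂, hc₂, hu₂⟩ := exists_dotProduct_ne_zero h2
  have z1 := hu₁ w.1 (Submodule.subset_span (by simp))
  have z2 := hu₁ w.2 (Submodule.subset_span (by simp))
  have z3 := hu₂ w.1 (Submodule.subset_span (by simp))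
  have z4 := hu₂ w.2 (Submodule.subset_span (by simp))
  have z5 := hu₂ w'.1 (Submodule.subset_span (by simp))
  refine sum_le_of_sum_shift_le (S := ZMod q × ZMod q) _ (fun x => x.1 • h₂ + x.2 • h₁) fun g => ?_
  have hq : (Fintype.card (ZMod q × ZMod q) : ℝ) = (q : ℝ) ^ 2 := by
    rw [Fintype.card_prod, ZMod.card]; push_cast; ring
  rw [hq]
  refine le_trans (le_of_eq ?_) (hG.plane (g ⬝ᵥ w.1) (g ⬝ᵥ w.2))
  rw [← Equiv.sum_comp (Equiv.prodComm (ZMod q) (ZMod q))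
      (fun x => meanRatio snr (distScore snr) (superposition γ (g ⬝ᵥ w.1) (g ⬝ᵥ w.2) -
        superposition γ x.1 x.2))]
  refine Eq.trans ?_ (sum_triangular_comp (fun y x => meanRatio snr (distScore snr)
    (superposition γ (g ⬝ᵥ w.1) (g ⬝ᵥ w.2) - superposition γ x y))
    (g ⬝ᵥ w'.2) (g ⬝ᵥ w'.1) (h₁ ⬝ᵥ w'.2) hc₂ hc₁)
  refine Finset.sum_congr rfl fun x _ => ?_
  simp only [columnOutput, add_dotProduct, smul_dotProduct, smul_eq_mul, z1, z2, z3, z4, z5,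
    mul_zero, zero_add, add_zero]

end RandomCode

end

end LinearMAC

/-! ### The centred constellation and the random coding bound. -/

namespace LinearMAC

noncomputable section

lemma sum_valMinAbs {q r : ℕ} [NeZero q] (hq : q = 2 * r + 1) {M : Type*} [AddCommMonoid M]
    (F : ℤ → M) : ∑ a : ZMod q, F a.valMinAbs = ∑ i ∈ Finset.range q, F (i - r) := by
  refine Finset.sum_nbij' (fun a => (a.valMinAbs + r).toNat)
    (fun i => (((i : ℤ) - r : ℤ) : ZMod q)) ?_ ?_ ?_ ?_ ?_
  · intro a _
    have := a.valMinAbs_mem_Ioc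
    simp only [Set.mem_Ioc] at this
    rw [Finset.mem_range]; omega
  · intro i _; exact Finset.mem_univ _
  · intro a _
    have := a.valMinAbs_mem_Ioc
    simp only [Set.mem_Ioc] at this
    rw [Int.toNat_of_nonneg (by omega), add_sub_cancel_right, ZMod.coe_valMinAbs]
  · intro i hi
    rw [Finset.mem_range] at hi
    have : (((i : ℤ) - r : ℤ) : ZMod q).valMinAbs = i - r :=
      (ZMod.valMinAbs_spec _ _).2 ⟨rfl, by constructor <;> omega⟩
    rw [this]; omega
  · intro a _
    have := a.valMinAbs_mem_Ioc
    simp only [Set.mem_Ioc] at this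
    rw [Int.toNat_of_nonneg (by omega), add_sub_cancel_right]

lemma sum_range_centred_sq (r : ℕ) :
    ∑ i ∈ Finset.range (2 * r + 1), ((i : ℝ) - r) ^ 2 = r * (r + 1) * (2 * r + 1) / 3 := by
  have h : ∀ (c : ℝ) (n : ℕ), ∑ i ∈ Finset.range n, ((i : ℝ) - c) ^ 2 =
      n * (n - 1) * (2 * n - 1) / 6 - c * (n * (n - 1)) + n * c ^ 2 := by
    intro c n
    induction n with
    | zero => simp
    | succ n ih => rw [Finset.sum_range_succ, ih]; push_cast; ring
  rw [h]; push_cast; ring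

section

variable {q : ℕ} [NeZero q]

lemma abs_valMinAbs_lt (hq : Odd q) (a : ZMod q) : 2 * |a.valMinAbs| < q := by
  have := a.valMinAbs_mem_Ioc
  obtain ⟨r, rfl⟩ := hq
  simp only [Set.mem_Ioc] at this
  push_cast at this ⊢
  rcases abs_cases a.valMinAbs with h | h <;> omega

lemma constellation_mem (hq : Odd q) (a : ZMod q) : constellation a ∈ basicInterval := by
  have hq0 : (0 : ℝ) < q := by exact_mod_cast Nat.pos_of_ne_zero (NeZero.ne q)
  have h : (2 : ℝ) * |(a.valMinAbs : ℝ)| < q := by exact_mod_cast abs_valMinAbs_lt hq a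
  have h2 : |constellation a| < L / 2 := by
    rw [constellation, abs_mul, abs_of_pos (div_pos L_pos hq0), div_mul_eq_mul_div,
      div_lt_div_iff₀ hq0 two_pos]
    nlinarith [L_pos]
  exact ⟨(abs_lt.1 h2).1.le, (abs_lt.1 h2).2⟩

lemma exists_constellation_eq {a : ZMod q} {m : ℤ} (h : (m : ZMod q) = a) :
    ∃ k : ℤ, L / q * m = constellation a + k * L := by
  have hq0 : (q : ℝ) ≠ 0 := by exact_mod_cast NeZero.ne q
  have h1 : ((m - a.valMinAbs : ℤ) : ZMod q) = 0 := by
    push_cast; rw [h, sub_self]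
  obtain ⟨k, hk⟩ := (ZMod.intCast_zmod_eq_zero_iff_dvd _ _).1 h1
  refine ⟨k, ?_⟩
  have h2 : (m : ℝ) = a.valMinAbs + q * k := by
    have : m = a.valMinAbs + q * k := by linarith
    exact_mod_cast this
  rw [h2, constellation]
  field_simp

lemma star_constellation_add (hq : Odd q) (a b : ZMod q) :
    star (constellation a + constellation b) = constellation (a + b) := by
  obtain ⟨k, hk⟩ := exists_constellation_eq (a := a + b) (m := a.valMinAbs + b.valMinAbs)
    (by push_cast; rfl)
  refine star_eq_of_mem (constellation_mem hq _) k ?_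
  rw [← hk, constellation, constellation]
  push_cast; ring

/-- With q = 2r+1 the sum equals (12/q²)·r(r+1)q/3 = q(1 - 1/q²). -/
lemma sum_constellation_sq_le (hq : Odd q) : ∑ a : ZMod q, constellation a ^ 2 ≤ q := by
  obtain ⟨r, hr⟩ := hq
  have h1 : ∑ a : ZMod q, constellation a ^ 2 = _ :=
    sum_valMinAbs hr (fun n : ℤ => (L / q * n) ^ 2)
  have h2 : ∀ i : ℕ, (L / q * ((i - r : ℤ) : ℝ)) ^ 2 = 12 / (q : ℝ) ^ 2 * ((i : ℝ) - r) ^ 2 := by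
    intro i
    rw [mul_pow, div_pow, L_sq]; push_cast; ring
  rw [h1, Finset.sum_congr rfl fun i _ => h2 i, ← Finset.mul_sum, hr, sum_range_centred_sq]
  push_cast
  have : (0 : ℝ) < 2 * r + 1 := by positivity
  rw [div_mul_div_comm, div_le_iff₀ (by positivity)]
  nlinarith [sq_nonneg (2 * (r : ℝ) + 1)]

end

variable {γ snr : ℝ} {q : ℕ} [Fact q.Prime]

/-- A zero column gives the zero symbol; a nonzero column makes the label uniform. Hence every
generator matrix, not only a typical one, meets the power constraint. -/
lemma sum_dotProduct_constellation_sq_le (hq : Odd q) {k : ℕ} (g : Fin k → ZMod q) :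
    ∑ w : Fin k → ZMod q, constellation (g ⬝ᵥ w) ^ 2 ≤ (q : ℝ) ^ k := by
  by_cases hg : g = 0
  · subst hg
    simp [constellation]
  · obtain ⟨h, hh, -⟩ := exists_dotProduct_ne_zero (K := ZMod q)
      (p := (⊥ : Submodule (ZMod q) (Fin k → ZMod q))) (v := g) (by simpa using hg)
    have := sum_le_of_sum_shift_le (S := ZMod q) (B := 1)
      (fun w : Fin k → ZMod q => constellation (g ⬝ᵥ w) ^ 2) (fun s => s • h) fun w => by
        rw [ZMod.card, mul_one]
        refine le_trans (le_of_eq ?_) (sum_constellation_sq_le hq)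
        rw [← sum_affine_comp (fun a => constellation a ^ 2) (g ⬝ᵥ w) hh]
        refine Finset.sum_congr rfl fun s _ => ?_
        simp only [dotProduct_add, dotProduct_smul, smul_eq_mul, dotProduct_comm g h]
    refine this.trans_eq ?_
    simp [ZMod.card]

open Classical in
/-- The scoring function with which the messages `w` and `w'` are compared. -/
def pairScore {V : Type*} [AddCommGroup V] [Module (ZMod q) V] (snr lam : ℝ) (w w' : V × V) :
    ℝ → ℝ :=
  if InSpan (ZMod q) w w' ∨ InSpan (ZMod q) w' w then cosScore lam else distScore snr

/-- The columns are chosen independently, so the sum over matrices of a product over coordinates is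
an n-th power. -/
lemma sum_prod_meanRatio_le (n : ℕ) {k : ℕ} {s : ℝ → ℝ} (hs : ∀ x, 0 < s x)
    {w w' : (Fin k → ZMod q) × (Fin k → ZMod q)} {c : ℝ}
    (h : ∑ g, meanRatio snr s (columnOutput γ g w - columnOutput γ g w') ≤
      Fintype.card (Fin k → ZMod q) * c) :
    ∑ G : Fin n → Fin k → ZMod q, ∏ t,
      meanRatio snr s (columnOutput γ (G t) w - columnOutput γ (G t) w') ≤
        ((q : ℝ) ^ k) ^ n * c ^ n := by
  rw [← Fintype.sum_pow (fun g => meanRatio snr s (columnOutput γ g w - columnOutput γ g w')),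
    ← mul_pow]
  have hc : (Fintype.card (Fin k → ZMod q) : ℝ) = (q : ℝ) ^ k := by simp [ZMod.card]
  rw [hc] at h
  exact pow_le_pow_left₀ (Finset.sum_nonneg fun g _ => meanRatio_nonneg hs _) h n

open Classical in
lemma sum_sum_prod_meanRatio_le (n : ℕ) {k : ℕ} {A B lam θ : ℝ}
    (hG : GoodConstellation γ snr q A B) (hA : 0 ≤ A) (hB : 0 ≤ B) (hθ0 : 0 ≤ θ)
    (hθ : ∀ T : ZMod q × ZMod q × ZMod q × ZMod q, T ≠ (1, 0, 0, 1) →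
      ∑ x : ZMod q × ZMod q, meanRatio snr (cosScore lam) (superposition γ x.1 x.2 -
        superposition γ (T.1 * x.1 + T.2.1 * x.2) (T.2.2.1 * x.1 + T.2.2.2 * x.2)) ≤
          (q : ℝ) ^ 2 * θ)
    {w : (Fin k → ZMod q) × (Fin k → ZMod q)} (hw : IndepPair (ZMod q) w) :
    ∑ w' ∈ Finset.univ.erase w, ∑ G : Fin n → Fin k → ZMod q, ∏ t,
      meanRatio snr (pairScore (q := q) snr lam w w')
        (columnOutput γ (G t) w - columnOutput γ (G t) w') ≤
        ((q : ℝ) ^ k) ^ n * ((q : ℝ) ^ 4 * θ ^ n +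
          ((q : ℝ) ^ 2 + (q : ℝ) ^ 3) * (q : ℝ) ^ k * B ^ n + ((q : ℝ) ^ k) ^ 2 * A ^ n) := by
  have hterm : ∀ w' ∈ Finset.univ.erase w, ∑ G : Fin n → Fin k → ZMod q, ∏ t,
      meanRatio snr (pairScore (q := q) snr lam w w')
        (columnOutput γ (G t) w - columnOutput γ (G t) w') ≤
        ((q : ℝ) ^ k) ^ n * ((if InSpan (ZMod q) w w' then θ ^ n else 0) +
          (if AlmostInSpan (ZMod q) w w' then B ^ n else 0) + A ^ n) := by
    intro w' hw'
    have hAn := pow_nonneg hA n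
    have hBn := pow_nonneg hB n
    have hθn := pow_nonneg hθ0 n
    have hqn : 0 ≤ ((q : ℝ) ^ k) ^ n := by positivity
    by_cases h2 : InSpan (ZMod q) w w'
    · have hps : pairScore (q := q) snr lam w w' = cosScore lam := if_pos (Or.inl h2)
      rw [hps, if_pos h2]
      refine (sum_prod_meanRatio_le n (cosScore_pos lam)
        (sum_column_inSpan_le hθ hw (Finset.ne_of_mem_erase hw') h2)).trans
        (mul_le_mul_of_nonneg_left ?_ hqn)
      split_ifs <;> linarith
    · have hps : pairScore (q := q) snr lam w w' = distScore snr :=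
        if_neg (not_or.2 ⟨h2, fun h => h2 (hw.inSpan_of_inSpan h)⟩)
      rw [hps, if_neg h2]
      by_cases h3 : AlmostInSpan (ZMod q) w w'
      · rw [if_pos h3]
        refine (sum_prod_meanRatio_le n (distScore_pos snr)
          (sum_column_le_of_not_inSpan hG h2)).trans (mul_le_mul_of_nonneg_left ?_ hqn)
        linarith
      · rw [if_neg h3]
        refine (sum_prod_meanRatio_le n (distScore_pos snr)
          (sum_column_le_of_not_almostInSpan hG h3)).trans (mul_le_mul_of_nonneg_left ?_ hqn)
        linarith
  have hnn : ∀ w', 0 ≤ (if InSpan (ZMod q) w w' then θ ^ n else 0) +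
          (if AlmostInSpan (ZMod q) w w' then B ^ n else 0) + A ^ n := by
    intro w'
    have hAn := pow_nonneg hA n
    have hBn := pow_nonneg hB n
    have hθn := pow_nonneg hθ0 n
    split_ifs <;> linarith
  refine (Finset.sum_le_sum hterm).trans ?_
  rw [← Finset.mul_sum]
  refine mul_le_mul_of_nonneg_left ?_ (by positivity)
  refine (Finset.sum_le_sum_of_subset_of_nonneg (Finset.subset_univ _)
    fun w' _ _ => hnn w').trans ?_
  rw [Finset.sum_add_distrib, Finset.sum_add_distrib, ← Finset.sum_filter, ← Finset.sum_filter,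
    Finset.sum_const, Finset.sum_const, Finset.sum_const, nsmul_eq_mul, nsmul_eq_mul, nsmul_eq_mul]
  have hV : Fintype.card (Fin k → ZMod q) = q ^ k := by simp [ZMod.card]
  have c2 := card_inSpan_le (K := ZMod q) w
  have c3 := card_almostInSpan_le (K := ZMod q) w
  rw [ZMod.card] at c2 c3
  rw [hV] at c3
  refine add_le_add (add_le_add ?_ ?_) ?_
  · exact mul_le_mul_of_nonneg_right (by exact_mod_cast c2) (pow_nonneg hθ0 n)
  · exact mul_le_mul_of_nonneg_right (by exact_mod_cast c3) (pow_nonneg hB n)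
  · refine mul_le_mul_of_nonneg_right (le_of_eq ?_) (pow_nonneg hA n)
    rw [Finset.card_univ, Fintype.card_prod, hV]; push_cast; ring

lemma GoodConstellation.exists_contracting {A B : ℝ} (hsnr : 0 < snr)
    (hG : GoodConstellation γ snr q A B) :
    ∃ lam θ : ℝ, 0 ≤ lam ∧ 0 ≤ θ ∧ θ < 1 ∧
      ∀ T : ZMod q × ZMod q × ZMod q × ZMod q, T ≠ (1, 0, 0, 1) →
      ∑ x : ZMod q × ZMod q, meanRatio snr (cosScore lam) (superposition γ x.1 x.2 -
        superposition γ (T.1 * x.1 + T.2.1 * x.2) (T.2.2.1 * x.1 + T.2.2.2 * x.2)) ≤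
          (q : ℝ) ^ 2 * θ := by
  obtain ⟨lam, θ, h0, h1, h2, h3⟩ := exists_cosScore_contracting hsnr
    (fun (T : {T : ZMod q × ZMod q × ZMod q × ZMod q // T ≠ (1, 0, 0, 1)})
      (x : ZMod q × ZMod q) => superposition γ x.1 x.2 -
        superposition γ (T.1.1 * x.1 + T.1.2.1 * x.2) (T.1.2.2.1 * x.1 + T.1.2.2.2 * x.2))
    (fun T => by
      obtain ⟨a, b, hab⟩ := hG.distinct T.1 T.2
      exact ⟨(a, b), hab⟩)
  refine ⟨lam, θ, h0, h1, h2, fun T hT => (h3 ⟨T, hT⟩).trans_eq ?_⟩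
  rw [Fintype.card_prod, ZMod.card]; push_cast; ring

/-- Random coding bound for linear codes over `ZMod q`. -/
theorem GoodConstellation.exists_code {A B : ℝ} (hsnr : 0 < snr) (hq : Odd q)
    (hG : GoodConstellation γ snr q A B) (hA : 0 ≤ A) (hB : 0 ≤ B) :
    ∃ θ : ℝ, 0 ≤ θ ∧ θ < 1 ∧ ∀ k n : ℕ, ∃ C : Code n (q ^ k), C.IsLinear ∧ C.power ≤ 1 ∧
      C.errorProb γ snr ≤ ((q : ℝ) + 1) / (q : ℝ) ^ k + ((q : ℝ) ^ 4 * θ ^ n +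
        ((q : ℝ) ^ 2 + (q : ℝ) ^ 3) * (q : ℝ) ^ k * B ^ n + ((q : ℝ) ^ k) ^ 2 * A ^ n) := by
  classical
  obtain ⟨lam, θ, hlam, hθ0, hθ1, hθ⟩ := hG.exists_contracting hsnr
  refine ⟨θ, hθ0, hθ1, fun k n => ?_⟩
  have hq0 : (0 : ℝ) < q := by exact_mod_cast (Fact.out : q.Prime).pos
  set E : ℝ := (q : ℝ) ^ 4 * θ ^ n + ((q : ℝ) ^ 2 + (q : ℝ) ^ 3) * (q : ℝ) ^ k * B ^ n +
    ((q : ℝ) ^ k) ^ 2 * A ^ n with hE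
  have hE0 : 0 ≤ E := by positivity
  let V := Fin k → ZMod q
  have hV : Fintype.card V = q ^ k := by simp [V, ZMod.card]
  have hdec := fun G : Fin n → V => exists_decoder snr
    (fun (w : V × V) t => columnOutput γ (G t) w) (pairScore (q := q) snr lam)
    (fun w w' => by simp only [pairScore, or_comm])
    (fun w w' => by
      unfold pairScore; split_ifs
      exacts [measurable_cosScore lam, measurable_distScore snr])
    (fun w w' x m => by
      unfold pairScore; split_ifs
      exacts [cosScore_add_int_mul lam x m, distScore_add_int_mul snr x m])
    (fun w w' => by
      unfold pairScore; split_ifs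
      exacts [⟨_, _, Real.exp_pos _, le_cosScore hlam, cosScore_le hlam⟩,
        ⟨_, _, Real.exp_pos _, le_distScore hsnr, distScore_le_one hsnr⟩])
  choose dec hmeas herr using hdec
  let err : (Fin n → V) → V × V → ℝ := fun G w =>
    (noise n snr).real {z | dec G (fun t => star (columnOutput γ (G t) w + z t)) ≠ w}
  have hnoise : IsProbabilityMeasure (noise n snr) := by unfold noise; infer_instance
  -- Message pairs with dependent components are written off as errors; they are a fraction of at
  -- most (q+1)/q^k of all pairs.
  have hw : ∀ w : V × V, ∑ G, err G w ≤
      ((q : ℝ) ^ k) ^ n * ((if ¬ IndepPair (ZMod q) w then 1 else 0) + E) := by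
    intro w
    by_cases hI : IndepPair (ZMod q) w
    · rw [if_neg (not_not.2 hI), zero_add]
      refine (Finset.sum_le_sum fun G _ => herr G w).trans ?_
      rw [Finset.sum_comm]
      exact sum_sum_prod_meanRatio_le n hG hA hB hθ0 hθ hI
    · rw [if_pos hI]
      have : ∑ G, err G w ≤ ((q : ℝ) ^ k) ^ n * 1 := by
        refine (Finset.sum_le_sum fun G _ => measureReal_le_one).trans_eq ?_
        simp [V, ZMod.card]
      exact this.trans (mul_le_mul_of_nonneg_left (by linarith) (by positivity))
  have hcard := card_not_indepPair_le (K := ZMod q) (V := V)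
  rw [ZMod.card, hV] at hcard
  have htot : ∑ G, ∑ w, err G w ≤ ∑ _G : Fin n → V,
      (((q : ℝ) + 1) * (q : ℝ) ^ k + ((q : ℝ) ^ k) ^ 2 * E) := by
    rw [Finset.sum_comm]
    refine (Finset.sum_le_sum fun w _ => hw w).trans ?_
    rw [← Finset.mul_sum, Finset.sum_const, nsmul_eq_mul, Finset.sum_add_distrib,
      ← Finset.sum_filter, Finset.sum_const, Finset.sum_const, nsmul_eq_mul, nsmul_eq_mul]
    have e1 : ((Finset.univ : Finset (Fin n → V)).card : ℝ) = ((q : ℝ) ^ k) ^ n := by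
      simp [V, ZMod.card]
    have e2 : ((Finset.univ : Finset (V × V)).card : ℝ) = ((q : ℝ) ^ k) ^ 2 := by
      rw [Finset.card_univ, Fintype.card_prod, hV]; push_cast; ring
    rw [e1, e2, mul_one]
    refine mul_le_mul_of_nonneg_left (add_le_add ?_ le_rfl) (by positivity)
    exact_mod_cast hcard
  obtain ⟨G, -, hGle⟩ := Finset.exists_le_of_sum_le Finset.univ_nonempty htot
  let e : Fin (q ^ k) ≃ V := (Fintype.equivFinOfCardEq hV).symm
  let C : Code n (q ^ k) :=
    { enc := fun i t => constellation (G t ⬝ᵥ e i)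
      enc_mem := fun i t => constellation_mem hq _
      dec := fun y => (e.symm (dec G y).1, e.symm (dec G y).2)
      measurable_dec := by
        refine measurable_to_countable' fun w => ?_
        have : (fun y => (e.symm (dec G y).1, e.symm (dec G y).2)) ⁻¹' {w} =
            dec G ⁻¹' {(e w.1, e w.2)} := by
          ext y
          simp only [Set.mem_preimage, Set.mem_singleton_iff, Prod.ext_iff, Equiv.symm_apply_eq]
        rw [this]
        exact hmeas G _ }
  refine ⟨C, ?_, ?_, ?_⟩
  · intro w₁ w₂
    refine ⟨e.symm (e w₁ + e w₂), ?_⟩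
    ext t
    simp only [C, star_constellation_add hq, Equiv.apply_symm_apply]
    rw [← dotProduct_add]
  · have h1 : ∑ w : Fin (q ^ k), ∑ t : Fin n, C.enc w t ^ 2 ≤ n * (q : ℝ) ^ k := by
      rw [Finset.sum_comm]
      refine (Finset.sum_le_sum fun t _ => ?_).trans_eq
        (by rw [Finset.sum_const, Finset.card_univ, Fintype.card_fin, nsmul_eq_mul])
      exact (Equiv.sum_comp e fun w => constellation (G t ⬝ᵥ w) ^ 2).trans_le
        (sum_dotProduct_constellation_sq_le hq (G t))
    rw [Code.power]
    push_cast
    calc 1 / (n : ℝ) * (1 / (q : ℝ) ^ k * ∑ w : Fin (q ^ k), ∑ t : Fin n, C.enc w t ^ 2)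
        ≤ 1 / (n : ℝ) * (1 / (q : ℝ) ^ k * (n * (q : ℝ) ^ k)) := by gcongr
      _ = (n : ℝ) / n := by field_simp
      _ ≤ 1 := div_self_le_one _
  · have h1 : ∑ w : Fin (q ^ k) × Fin (q ^ k), (noise n snr).real
        {z | C.dec (channelOutput γ (C.enc w.1) (C.enc w.2) z) ≠ w} = ∑ w, err G w := by
      rw [← Equiv.sum_comp (Equiv.prodCongr e e)]
      refine Finset.sum_congr rfl fun w _ => ?_
      simp only [err]
      congr 1
      ext z
      simp only [Set.mem_ofPred_eq, ne_eq, C, Prod.ext_iff, Equiv.symm_apply_eq,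
        Equiv.prodCongr_apply, Prod.map]
      rfl
    rw [Code.errorProb, h1]
    push_cast
    calc 1 / ((q : ℝ) ^ k) ^ 2 * ∑ w, err G w
        ≤ 1 / ((q : ℝ) ^ k) ^ 2 * (((q : ℝ) + 1) * (q : ℝ) ^ k + ((q : ℝ) ^ k) ^ 2 * E) := by
          gcongr
      _ = ((q : ℝ) + 1) / (q : ℝ) ^ k + E := by field_simp

end

end LinearMAC

/-! ### Single-letter bounds for an odd prime with δ ≠ 0. -/

namespace LinearMAC

noncomputable section

variable {γ snr : ℝ} {q : ℕ}

lemma meanRatio_distScore_add_int_mul (Δ : ℝ) (k : ℤ) :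
    meanRatio snr (distScore snr) (Δ + k * L) = meanRatio snr (distScore snr) Δ := by
  simp only [meanRatio, ← add_assoc, distScore_add_int_mul]

lemma valMinAbs_injective [NeZero q] {a b : ZMod q} (h : a.valMinAbs = b.valMinAbs) : a = b := by
  rw [← ZMod.coe_valMinAbs a, h, ZMod.coe_valMinAbs]

/-- With the second user's label fixed, the q competing points are 1/q-separated on the circle, and
all their distances to 0 are bounded below by the distance from m/L to the multiples of 1/q. -/
lemma sum_meanRatio_constellation_le [NeZero q] (hsnr : 0 < snr) (m : ℝ) {e : ℝ} (he : 0 ≤ e)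
    (hm : ∀ j : ℤ, e ≤ |m / L + j / q|) :
    ∑ a : ZMod q, meanRatio snr (distScore snr) (m - constellation a) ≤
      Real.exp (-(3 * snr / 2) * e ^ 2) + √((2 * Real.pi / 3) / snr) * q := by
  have hq0 : (0 : ℝ) < q := by exact_mod_cast Nat.pos_of_ne_zero (NeZero.ne q)
  have hq1 : (1 : ℝ) ≤ q := by exact_mod_cast Nat.one_le_iff_ne_zero.2 (NeZero.ne q)
  have hL := L_pos.ne'
  have h := sum_meanRatio_le hsnr (Finset.univ : Finset (ZMod q))
    (fun a => m / L - a.valMinAbs / q) (h := 1 / q) (by positivity)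
    ((div_le_one hq0).2 hq1) he ?_ ?_
  · rw [div_div_eq_mul_div, div_one] at h
    refine le_trans (le_of_eq (Finset.sum_congr rfl fun a _ => ?_)) h
    congr 1
    rw [constellation]; field_simp
  · intro a _ b _ hab k
    have hne : b.valMinAbs - a.valMinAbs + q * k ≠ 0 := by
      intro h0
      apply hab
      have : ((b.valMinAbs - a.valMinAbs + q * k : ℤ) : ZMod q) = 0 := by rw [h0]; simp
      push_cast at this
      rw [ZMod.natCast_self, zero_mul, add_zero, sub_eq_zero] at this
      exact this.symm
    have h1 : (1 : ℝ) ≤ |((b.valMinAbs - a.valMinAbs + q * k : ℤ) : ℝ)| := by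
      rw [← Int.cast_abs]; exact_mod_cast Int.one_le_abs hne
    have h2 : m / L - a.valMinAbs / q - (m / L - b.valMinAbs / q) + k =
        ((b.valMinAbs - a.valMinAbs + q * k : ℤ) : ℝ) / q := by
      push_cast; field_simp; ring
    rw [h2, abs_div, abs_of_pos hq0]
    gcongr
  · intro a _ k
    refine (hm (-a.valMinAbs + q * k)).trans_eq ?_
    congr 1; push_cast; field_simp; ring

/-- Line averages are controlled by sums over orbits of circle rotations. -/
lemma sum_line_le [Fact q.Prime] (hsnr : 0 < snr) (hq : Odd q) {D : ℝ}
    (hD1 : 1 + √((2 * Real.pi / 3) / snr) * q ≤ D)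
    (hD : ∀ (l : ℤ) (x : ℝ), ∑ i ∈ Finset.range q,
      meanRatio snr (distScore snr) (L * (x - i * ((l + γ) / q))) ≤ D)
    (m : ℝ) (a b c d : ZMod q) (hcd : c ≠ 0 ∨ d ≠ 0) :
    ∑ s : ZMod q, meanRatio snr (distScore snr) (m - superposition γ (a + s * c) (b + s * d)) ≤
      D := by
  have hq0 : (q : ℝ) ≠ 0 := by exact_mod_cast (Fact.out : q.Prime).ne_zero
  have hL := L_pos.ne'
  by_cases hd : d = 0
  · have hc : c ≠ 0 := hcd.resolve_right (not_not.2 hd)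
    have h := sum_meanRatio_constellation_le (q := q) hsnr (m - γ * constellation b) le_rfl
      (fun _ => abs_nonneg _)
    rw [← sum_affine_comp (fun y => meanRatio snr (distScore snr)
      (m - γ * constellation b - constellation y)) a hc] at h
    refine le_trans (le_of_eq (Finset.sum_congr rfl fun s _ => ?_)) (h.trans ?_)
    · rw [hd, mul_zero, add_zero, superposition]; congr 1; ring
    · simpa using hD1
  · obtain ⟨r, hr⟩ := hq
    -- Parametrise the line by the second label y. The first is a' + l·y, and modulo L the sum
    -- becomes an orbit of the rotation by (l+γ)/q. Since γ need not be an integer, y must run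
    -- through its centred representatives -r, …, r, hence the starting offset by r steps.
    set l := c / d
    set a' := a - b * l
    refine le_trans (le_of_eq ?_)
      (hD l.valMinAbs (m / L - a'.valMinAbs / q + r * ((l.valMinAbs + γ) / q)))
    have e1 : ∀ s : ZMod q, meanRatio snr (distScore snr)
        (m - superposition γ (a + s * c) (b + s * d)) =
        (fun y : ZMod q => meanRatio snr (distScore snr) (m - superposition γ (a' + l * y) y))
          (b + s * d) := by
      intro s
      have : a + s * c = a' + l * (b + s * d) := by
        simp only [a', l]; field_simp; ring
      simp only [this]
    refine (Finset.sum_congr rfl fun s _ => e1 s).trans ((sum_affine_comp (fun y : ZMod q =>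
      meanRatio snr (distScore snr) (m - superposition γ (a' + l * y) y)) b hd).trans ?_)
    have e2 : ∀ y : ZMod q, meanRatio snr (distScore snr) (m - superposition γ (a' + l * y) y) =
        (fun v : ℤ => meanRatio snr (distScore snr)
          (L * (m / L - a'.valMinAbs / q - v * ((l.valMinAbs + γ) / q)))) y.valMinAbs := by
      intro y
      obtain ⟨k, hk⟩ := exists_constellation_eq (a := a' + l * y)
        (m := a'.valMinAbs + l.valMinAbs * y.valMinAbs) (by push_cast; simp)
      show _ = meanRatio snr (distScore snr) _
      rw [← meanRatio_distScore_add_int_mul _ (-k)]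
      congr 1
      have hk' : constellation (a' + l * y) =
        L / q * (a'.valMinAbs + l.valMinAbs * y.valMinAbs) - k * L := by
        push_cast at hk; linarith
      rw [superposition, hk', constellation]
      push_cast; field_simp; ring
    refine ((Finset.sum_congr rfl fun y _ => e2 y).trans (sum_valMinAbs hr (fun v : ℤ =>
      meanRatio snr (distScore snr)
        (L * (m / L - a'.valMinAbs / q - v * ((l.valMinAbs + γ) / q)))))).trans ?_
    refine Finset.sum_congr rfl fun i _ => ?_
    congr 2; push_cast; ring

lemma exists_superposition_sub_eq [NeZero q] {a b a' b' : ZMod q} {k : ℤ}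
    (h : superposition γ a b - superposition γ a' b' = k * L) :
    γ * ((b.valMinAbs - b'.valMinAbs : ℤ) : ℝ) =
      ((a'.valMinAbs - a.valMinAbs + k * q : ℤ) : ℝ) := by
  have hq0 : (q : ℝ) ≠ 0 := by exact_mod_cast NeZero.ne q
  have hL := L_pos.ne'
  simp only [superposition, constellation] at h
  field_simp at h
  push_cast; linarith

lemma eq_of_superposition_sub_eq [NeZero q] {a a' b : ZMod q} {k : ℤ}
    (h : superposition γ a b - superposition γ a' b = k * L) : a' = a := by
  have := exists_superposition_sub_eq h
  rw [sub_self, Int.cast_zero, mul_zero] at this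
  have h0 : a'.valMinAbs - a.valMinAbs + k * q = 0 := by exact_mod_cast this.symm
  have h1 : ((a'.valMinAbs - a.valMinAbs + k * q : ℤ) : ZMod q) = 0 := by rw [h0]; simp
  push_cast at h1
  rwa [ZMod.natCast_self, mul_zero, add_zero, sub_eq_zero] at h1

/-- Once the second labels agree, equal noiseless outputs force equal first labels modulo q. So only
the second label has to be recovered. -/
lemma exists_ne_of_forall_snd_eq [NeZero q]
    (h : ∀ T : ZMod q × ZMod q × ZMod q × ZMod q, (∀ a b : ZMod q, ∃ k : ℤ,
      superposition γ a b - superposition γ (T.1 * a + T.2.1 * b) (T.2.2.1 * a + T.2.2.2 * b) =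
        k * L) → ∀ a b : ZMod q, T.2.2.1 * a + T.2.2.2 * b = b)
    (T : ZMod q × ZMod q × ZMod q × ZMod q) (hT : T ≠ (1, 0, 0, 1)) :
    ∃ a b : ZMod q, ∀ k : ℤ, superposition γ a b -
      superposition γ (T.1 * a + T.2.1 * b) (T.2.2.1 * a + T.2.2.2 * b) ≠ k * L := by
  by_contra hn
  push Not at hn
  have h2 := h T hn
  have h1 : ∀ a b : ZMod q, T.1 * a + T.2.1 * b = a := by
    intro a b
    obtain ⟨k, hk⟩ := hn a b
    rw [h2 a b] at hk
    exact eq_of_superposition_sub_eq hk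
  obtain ⟨t1, t2, t3, t4⟩ := T
  have e1 := h1 1 0
  have e2 := h1 0 1
  have e3 := h2 1 0
  have e4 := h2 0 1
  simp only [mul_one, mul_zero, add_zero, zero_add] at e1 e2 e3 e4
  exact hT (by rw [e1, e2, e3, e4])

section Delta

lemma delta_nonneg (p : ℕ) (γ : ℝ) : 0 ≤ delta p γ :=
  Real.sInf_nonneg (by rintro _ ⟨l, -, rfl⟩; positivity)

lemma mul_abs_sub_round_div {l : ℕ} (hl : 0 < l) (γ : ℝ) :
    (l : ℝ) * |γ - (round ((l : ℝ) * γ) : ℝ) / (l : ℝ)| = |l * γ - round ((l : ℝ) * γ)| := by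
  have hl' : (0 : ℝ) < l := by exact_mod_cast hl
  rw [← abs_of_pos hl', ← abs_mul, abs_of_pos hl']
  congr 1; field_simp

/-- δ is the least distance from mγ to the integers over 0 < |m| < p; differences of two centred
representatives are such m. -/
lemma delta_le_abs {p : ℕ} {m : ℤ} (hm : m ≠ 0) (hmp : |m| < p) (j : ℤ) :
    delta p γ ≤ |m * γ + j| := by
  have key : ∀ (l : ℕ) (j : ℤ), 0 < l → l < p → delta p γ ≤ |l * γ + j| := by
    intro l j hl hlp
    have hbdd : BddBelow ((fun l : ℕ => (l : ℝ) * |γ - (round ((l : ℝ) * γ) : ℝ) / (l : ℝ)|) ''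
        Set.Ioo 0 p) := ⟨0, by rintro _ ⟨l, -, rfl⟩; positivity⟩
    refine (csInf_le hbdd (Set.mem_image_of_mem _ ⟨hl, hlp⟩)).trans ?_
    rw [mul_abs_sub_round_div hl]
    refine (round_le ((l : ℝ) * γ) (-j)).trans_eq ?_
    push_cast; rw [sub_neg_eq_add]
  have hcast : ((m.natAbs : ℕ) : ℤ) = |m| := Int.natCast_natAbs m
  have hpos : 0 < m.natAbs := Int.natAbs_pos.2 hm
  have hlt : m.natAbs < p := by omega
  rcases le_total 0 m with h | h
  · have h1 := key m.natAbs j hpos hlt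
    have : ((m.natAbs : ℕ) : ℝ) = m := by
      rw [Nat.cast_natAbs, abs_of_nonneg h]
    rwa [this] at h1
  · have h1 := key m.natAbs (-j) hpos hlt
    have : ((m.natAbs : ℕ) : ℝ) = -m := by
      rw [Nat.cast_natAbs, abs_of_nonpos h, Int.cast_neg]
    rw [this] at h1
    refine h1.trans_eq ?_
    rw [← abs_neg]; congr 1; push_cast; ring

lemma delta_le_half {p : ℕ} (hp : 2 ≤ p) : delta p γ ≤ 1 / 2 := by
  have := delta_le_abs (γ := γ) (p := p) one_ne_zero (by rw [abs_one]; exact_mod_cast hp) (-round γ)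
  refine this.trans ?_
  push_cast
  rw [one_mul, ← sub_eq_add_neg]
  exact abs_sub_round γ

lemma delta_two (γ : ℝ) : delta 2 γ = |γ - round γ| := by
  have : Set.Ioo 0 2 = ({1} : Set ℕ) := by 
    ext l; simp only [Set.mem_Ioo, Set.mem_singleton_iff]; omega
  rw [delta, this, Set.image_singleton, csInf_singleton]
  simp

end Delta

lemma abs_sub_valMinAbs_lt [NeZero q] (hq : Odd q) (a b : ZMod q) :
    |a.valMinAbs - b.valMinAbs| < q := by
  have h1 := abs_valMinAbs_lt hq a
  have h2 := abs_valMinAbs_lt hq b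
  have := abs_sub a.valMinAbs b.valMinAbs
  omega

/-- The constellation over an odd prime with `δ ≠ 0`. -/
theorem goodConstellation_of_delta_ne_zero [Fact q.Prime] (hsnr : 0 < snr) (hq : Odd q)
    (hδ : delta q γ ≠ 0) :
    GoodConstellation γ snr q
      (1 / (q : ℝ) ^ 2 + √((2 * Real.pi / 3) / snr) +
        1 / (q : ℝ) * Real.exp (-(3 * snr / (2 * (q : ℝ) ^ 2)) * delta q γ ^ 2))
      (1 / (q : ℝ) + √((2 * Real.pi / 3) / (delta q γ ^ 2 * snr))) := by
  have hprime : q.Prime := Fact.out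
  have hq0 : (0 : ℝ) < q := by exact_mod_cast hprime.pos
  have hq1 : (1 : ℝ) ≤ q := by exact_mod_cast hprime.one_lt.le
  have hδ0 : 0 < delta q γ := lt_of_le_of_ne (delta_nonneg q γ) (Ne.symm hδ)
  have hδ1 : delta q γ ≤ 1 / 2 := delta_le_half hprime.two_le
  have hL := L_pos.ne'
  set δ := delta q γ
  set τ := √((2 * Real.pi / 3) / snr) with hτ
  have hτ0 : 0 ≤ τ := Real.sqrt_nonneg _
  have hτδ : √((2 * Real.pi / 3) / (δ ^ 2 * snr)) = τ / δ := by
    rw [mul_comm (δ ^ 2), ← div_div, Real.sqrt_div (by positivity), Real.sqrt_sq hδ0.le]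
  refine ⟨fun a b => ?_, ?_, ?_⟩
  · set X := Real.exp (-(3 * snr / (2 * (q : ℝ) ^ 2)) * δ ^ 2) with hX
    have hX' : Real.exp (-(3 * snr / 2) * (δ / q) ^ 2) = X := by
      rw [hX]; congr 1; field_simp
    -- Only the row b' = b can contain the true point and contribute 1; each other row is at circle
    -- distance at least δ/q from 0. Summing the rows gives 1 + qX + τq².
    have hb' : ∀ b' : ZMod q, ∑ a' : ZMod q, meanRatio snr (distScore snr)
        (superposition γ a b - superposition γ a' b') ≤ (if b' = b then 1 else 0) + (X + τ * q) := by
      intro b'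
      have hsum : ∀ a' : ZMod q, superposition γ a b - superposition γ a' b' =
          (superposition γ a b - γ * constellation b') - constellation a' := by
        intro a'; simp only [superposition]; ring
      simp only [hsum]
      split_ifs with h
      · have := sum_meanRatio_constellation_le (q := q) hsnr
          (superposition γ a b - γ * constellation b') le_rfl (fun _ => abs_nonneg _)
        simp only [ne_eq, OfNat.ofNat_ne_zero, not_false_eq_true, zero_pow, mul_zero,
          Real.exp_zero] at this
        have hXpos := Real.exp_pos (-(3 * snr / (2 * (q : ℝ) ^ 2)) * δ ^ 2)
        linarith
      · rw [zero_add, ← hX']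
        refine sum_meanRatio_constellation_le (q := q) hsnr _ (by positivity) fun j => ?_
        have hne : b.valMinAbs - b'.valMinAbs ≠ 0 := fun h0 =>
          h (valMinAbs_injective (sub_eq_zero.1 h0)).symm
        have h1 := delta_le_abs (γ := γ) hne (abs_sub_valMinAbs_lt hq b b') (a.valMinAbs + j)
        have h2 : (superposition γ a b - γ * constellation b') / L + j / q =
            (((b.valMinAbs - b'.valMinAbs : ℤ) : ℝ) * γ + ((a.valMinAbs + j : ℤ) : ℝ)) / q := by
          simp only [superposition, constellation]; push_cast; field_simp; ring
        rw [h2, abs_div, abs_of_pos hq0]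
        gcongr
    rw [Fintype.sum_prod_type_right]
    refine (Finset.sum_le_sum fun b' _ => hb' b').trans_eq ?_
    rw [Finset.sum_add_distrib, Finset.sum_ite_eq', Finset.sum_const, Finset.card_univ, ZMod.card]
    simp only [Finset.mem_univ, if_true, nsmul_eq_mul]
    field_simp; ring
  · rw [hτδ]
    refine sum_line_le hsnr hq ?_ ?_
    · rw [mul_add, mul_one_div_cancel hq0.ne', mul_comm]
      have : τ ≤ τ / δ := le_div_self hτ0 hδ0 (by linarith)
      gcongr
    · intro l x
      have h := sum_meanRatio_le hsnr (Finset.range q) (fun i : ℕ => x - i * ((l + γ) / q))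
        (h := δ / q) (by positivity) (by rw [div_le_one hq0]; linarith) le_rfl ?_
        (fun _ _ _ => abs_nonneg _)
      · refine h.trans_eq ?_
        simp only [ne_eq, OfNat.ofNat_ne_zero, not_false_eq_true, zero_pow, mul_zero,
          Real.exp_zero]
        rw [← hτ]
        field_simp
      · intro i hi j hj hij k
        rw [Finset.mem_range] at hi hj
        have hne : (j : ℤ) - i ≠ 0 := by omega
        have h1 := delta_le_abs (γ := γ) (p := q) hne (by rw [abs_lt]; omega)
          (((j : ℤ) - i) * l + q * k)
        have h2 : x - i * ((l + γ) / q) - (x - j * ((l + γ) / q)) + k =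
            ((((j : ℤ) - i : ℤ) : ℝ) * γ + ((((j : ℤ) - i) * l + q * k : ℤ) : ℝ)) / q := by
          push_cast; field_simp; ring
        rw [h2, abs_div, abs_of_pos hq0]
        gcongr
  · refine exists_ne_of_forall_snd_eq fun T hT a b => ?_
    obtain ⟨k, hk⟩ := hT a b
    have h1 := exists_superposition_sub_eq hk
    by_contra hne
    have h2 := delta_le_abs (γ := γ) (p := q)
      (m := b.valMinAbs - (T.2.2.1 * a + T.2.2.2 * b).valMinAbs)
      (fun h0 => hne (valMinAbs_injective (sub_eq_zero.1 h0)).symm)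
      (abs_sub_valMinAbs_lt hq _ _)
      (-((T.1 * a + T.2.1 * b).valMinAbs - a.valMinAbs + k * q))
    rw [mul_comm, h1, Int.cast_neg, add_neg_cancel, abs_zero] at h2
    exact absurd h2 (not_le.2 hδ0)

end

end LinearMAC

/-! ### Large primes in place of 2: rotation orbits and distinguishability. -/

namespace LinearMAC

noncomputable section

variable {γ snr : ℝ} {q : ℕ}

/-- With ε the signed distance from β to its nearest integer, |nε| lies between |ε| and (m-1)|ε| ≤ 1
- |ε|, so nβ is no closer to the integers than β is. -/
lemma abs_sub_round_le_abs_mul_add {β : ℝ} {m : ℕ} (hm : m * |β - round β| ≤ 1) {n : ℤ} (hn : n ≠ 0)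
    (hnm : |n| < m) (k : ℤ) : |β - round β| ≤ |n * β + k| := by
  set ε := β - round β with hε
  have e1 : n * β + k = n * ε + ((n * round β + k : ℤ) : ℝ) := by
    rw [hε]; push_cast; ring
  rw [e1]
  have hn1 : (1 : ℝ) ≤ |(n : ℝ)| := by rw [← Int.cast_abs]; exact_mod_cast Int.one_le_abs hn
  have hnm' : |(n : ℝ)| + 1 ≤ m := by
    rw [← Int.cast_abs]; exact_mod_cast hnm
  have hε0 := abs_nonneg ε
  by_cases hk : n * round β + k = 0
  · rw [hk, Int.cast_zero, add_zero, abs_mul]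
    exact le_mul_of_one_le_left hε0 hn1
  · have h1 : (1 : ℝ) ≤ |((n * round β + k : ℤ) : ℝ)| := by
      rw [← Int.cast_abs]; exact_mod_cast Int.one_le_abs hk
    have h2 := abs_sub_abs_le_abs_sub ((n * round β + k : ℤ) : ℝ) (-(n * ε))
    rw [sub_neg_eq_add, abs_neg, abs_mul] at h2
    rw [add_comm (n * ε)]
    nlinarith

/-- The sum over `m` consecutive points of a circle rotation that together do not wrap around. -/
lemma sum_rotation_le (hsnr : 0 < snr) {β : ℝ} {m : ℕ} (hβ : 0 < |β - round β|)
    (hm : m * |β - round β| ≤ 1) (x : ℝ) :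
    ∑ i ∈ Finset.range m, meanRatio snr (distScore snr) (L * (x - i * β)) ≤
      1 + √((2 * Real.pi / 3) / snr) / |β - round β| := by
  have h := sum_meanRatio_le hsnr (Finset.range m) (fun i : ℕ => x - i * β)
    (h := |β - round β|) hβ ((abs_sub_round β).trans (by norm_num)) le_rfl ?_
    (fun _ _ _ => abs_nonneg _)
  · simpa using h
  · intro i hi j hj hij k
    rw [Finset.mem_range] at hi hj
    refine (abs_sub_round_le_abs_mul_add hm (n := (j : ℤ) - i) (by omega)
      (by rw [abs_lt]; omega) k).trans_eq ?_
    congr 1; push_cast; ring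

lemma sum_rotation_le_mul (hsnr : 0 < snr) {β : ℝ} {m K N : ℕ} (hβ : 0 < |β - round β|)
    (hm : m * |β - round β| ≤ 1) (hN : N ≤ m * K) (x : ℝ) :
    ∑ i ∈ Finset.range N, meanRatio snr (distScore snr) (L * (x - i * β)) ≤
      K * (1 + √((2 * Real.pi / 3) / snr) / |β - round β|) := by
  have h : ∀ K : ℕ, ∑ i ∈ Finset.range (m * K), meanRatio snr (distScore snr) (L * (x - i * β)) ≤
      K * (1 + √((2 * Real.pi / 3) / snr) / |β - round β|) := by
    intro K
    induction K with
    | zero => simp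
    | succ K ih =>
      rw [Nat.mul_succ, Finset.sum_range_add]
      have h1 := sum_rotation_le hsnr hβ hm (x - (m * K : ℕ) * β)
      have h2 : ∀ i : ℕ, x - (m * K : ℕ) * β - i * β = x - (m * K + i : ℕ) * β := by
        intro i; push_cast; ring
      simp only [h2] at h1
      rw [Nat.cast_succ, add_mul, one_mul]
      exact add_le_add ih h1
  refine (Finset.sum_le_sum_of_subset_of_nonneg ?_ fun _ _ _ =>
    meanRatio_nonneg (distScore_pos snr) _).trans (h K)
  exact Finset.range_subset_range.2 hN

/-- Let d and ρ be the distances from γ and from β to the integers; qβ = l + γ gives d ≤ qρ. Cut the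
orbit into blocks that do not wrap around, each costing 1 + τ/ρ: blocks of two points if ρ ≥ d/2, a
single block if qρ ≤ 1, and about 2qρ blocks otherwise. -/
lemma sum_rotation_le_half (hsnr : 0 < snr) (hq : 1 ≤ q) (hγ : γ - round γ ≠ 0) (l : ℤ) (x : ℝ) :
    ∑ i ∈ Finset.range q, meanRatio snr (distScore snr) (L * (x - i * ((l + γ) / q))) ≤
      (q + 1) * (1 / 2 + √((2 * Real.pi / 3) / snr) / |γ - round γ|) := by
  have hq1 : (1 : ℝ) ≤ q := by exact_mod_cast hq
  have hq0 : (0 : ℝ) < q := by linarith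
  set d := |γ - round γ|
  have hd0 : 0 < d := abs_pos.2 hγ
  have hd1 : d ≤ 1 / 2 := abs_sub_round γ
  set τ := √((2 * Real.pi / 3) / snr)
  have hτ0 : 0 ≤ τ := Real.sqrt_nonneg _
  set β := (l + γ) / q with hβ
  set ρ := |β - round β|
  have hρ1 : ρ ≤ 1 / 2 := abs_sub_round β
  have hv : d ≤ q * ρ := by
    have h1 := round_le γ (q * round β - l)
    refine h1.trans_eq ?_
    simp only [ρ]
    rw [← abs_of_pos hq0, ← abs_mul, hβ]
    congr 1; push_cast; field_simp; ring
  have hρ0 : 0 < ρ := pos_of_mul_pos_right (hd0.trans_le hv) hq0.le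
  have hτd : 0 ≤ τ / d := by positivity
  by_cases h1 : d / 2 ≤ ρ
  · have h := sum_rotation_le_mul hsnr (m := 2) (K := (q + 1) / 2) (N := q) hρ0
      (by push_cast; linarith) (by omega) x
    refine h.trans ?_
    have hK : (((q + 1) / 2 : ℕ) : ℝ) ≤ ((q : ℝ) + 1) / 2 := by
      refine Nat.cast_div_le.trans_eq ?_; push_cast; rfl
    have hτρ : τ / ρ ≤ 2 * (τ / d) := by
      rw [mul_div_assoc', div_le_div_iff₀ hρ0 hd0]
      nlinarith
    calc (((q + 1) / 2 : ℕ) : ℝ) * (1 + τ / ρ) ≤ (((q : ℝ) + 1) / 2) * (1 + 2 * (τ / d)) := by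
          gcongr
      _ = _ := by ring
  · push Not at h1
    by_cases h2 : q * ρ ≤ 1
    · have h := sum_rotation_le hsnr (m := q) hρ0 h2 x
      refine h.trans ?_
      have : τ / ρ ≤ q * (τ / d) := by
        rw [mul_div_assoc', div_le_div_iff₀ hρ0 hd0]
        nlinarith
      nlinarith
    · push Not at h2
      set K := ⌊2 * (q * ρ)⌋₊ with hK
      have hKle : (K : ℝ) ≤ 2 * (q * ρ) := Nat.floor_le (by positivity)
      have hKlt : 2 * (q * ρ) < K + 1 := Nat.lt_floor_add_one _
      have hK2 : 2 ≤ K := Nat.le_floor (by push_cast; linarith)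
      have hK2' : (2 : ℝ) ≤ K := by exact_mod_cast hK2
      set m := ⌈(q : ℝ) / K⌉₊ with hm
      have hmge : (q : ℝ) / K ≤ m := Nat.le_ceil _
      have hmlt : (m : ℝ) < q / K + 1 := Nat.ceil_lt_add_one (by positivity)
      have hmρ : m * ρ ≤ 1 := by
        -- From 2qρ < K+1 and K ≥ 2, qρ/K is at most (K+1)/(2K) ≤ 3/4. Rounding the block length up
        -- costs at most ρ < d/2 ≤ 1/4 more.
        have e1 : (q : ℝ) / K * ρ ≤ 3 / 4 := by
          rw [div_mul_eq_mul_div, div_le_iff₀ (by linarith)]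
          linarith
        nlinarith
      have hqm : q ≤ m * K := by
        rw [div_le_iff₀ (by linarith)] at hmge
        exact_mod_cast hmge
      refine (sum_rotation_le_mul hsnr hρ0 hmρ hqm x).trans ?_
      have e2 : 2 * τ ≤ τ / d := by rw [le_div_iff₀ hd0]; nlinarith
      calc (K : ℝ) * (1 + τ / ρ) ≤ 2 * (q * ρ) * (1 + τ / ρ) := by gcongr
        _ = q * (2 * ρ + 2 * τ) := by field_simp
        _ ≤ q * (1 / 2 + τ / d) := by gcongr; linarith
        _ ≤ (q + 1) * (1 / 2 + τ / d) := by gcongr; linarith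

/-- Multiplication by `d ≠ 1` modulo `q` does not preserve centred representatives modulo the
integers `m` with `m γ` integral. -/
lemma eq_one_of_forall_valMinAbs_mul [Fact q.Prime] (hq : Odd q) (hq5 : 5 ≤ q)
    {D : AddSubgroup ℤ} (h1 : 1 ∉ D) (h2 : 2 ∉ D) (hqD : (q : ℤ) ∉ D) {d : ZMod q}
    (hd : ∀ b : ZMod q, b.valMinAbs - (d * b).valMinAbs ∈ D) : d = 1 := by
  obtain ⟨r, hr⟩ := hq
  have hval : ∀ m : ℤ, -r ≤ m → m ≤ r → ((m : ZMod q)).valMinAbs = m := by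
    intro m hm1 hm2
    exact (ZMod.valMinAbs_spec _ _).2 ⟨rfl, by constructor <;> omega⟩
  set t := d.valMinAbs with ht
  have htd : (t : ZMod q) = d := ZMod.coe_valMinAbs d
  have htr := d.valMinAbs_mem_Ioc
  simp only [Set.mem_Ioc] at htr
  rw [← ht] at htr
  have hone : 1 - t ∈ D := by
    have := hd ((1 : ℤ) : ZMod q)
    rw [hval 1 (by omega) (by omega)] at this
    simpa using this
  by_contra hne
  have ht1 : t ≠ 1 := fun h => hne (by rw [← htd, h]; simp)
  have ht0 : t ≠ 0 := fun h => h1 (by simpa [h] using hone)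
  have htm : t ≠ -1 := fun h => h2 (by simpa [h] using hone)
  -- The least n with n|t| > r. It satisfies n ≤ r, so it is its own representative, while n·t wraps
  -- around exactly once. Comparing the hypothesis at n with n(1 - t) ∈ D then puts q itself in D.
  set n : ℤ := r / |t| + 1 with hn
  have htabs : 2 ≤ |t| := by rcases abs_cases t with h | h <;> omega
  have htabs' : |t| ≤ r := by rcases abs_cases t with h | h <;> omega
  have hdiv1 : (r : ℤ) / |t| * |t| ≤ r := Int.ediv_mul_le _ (by omega)
  have hdiv2 : (r : ℤ) < (r / |t| + 1) * |t| := Int.lt_ediv_add_one_mul_self _ (by omega)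
  have hdiv3 : (r : ℤ) / |t| ≤ r / 2 := by
    have h0 : 0 ≤ (r : ℤ) / |t| := Int.ediv_nonneg (by omega) (by omega)
    have : (r : ℤ) / |t| * 2 ≤ r := by nlinarith
    omega
  have hn0 : 0 ≤ (r : ℤ) / |t| := Int.ediv_nonneg (by omega) (by omega)
  have hnt1 : (r : ℤ) < n * |t| := hdiv2
  have hnt2 : n * |t| ≤ 2 * r := by rw [hn, add_mul, one_mul]; omega
  have hnval : ((n : ZMod q)).valMinAbs = n := hval n (by omega) (by omega)
  have hbn := hd (n : ZMod q)
  rw [hnval] at hbn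
  have hmul : n * (1 - t) ∈ D := by
    rw [← smul_eq_mul]; exact D.zsmul_mem hone n
  rcases abs_cases t with ⟨ha, hs⟩ | ⟨ha, hs⟩
  · rw [ha] at hnt1 hnt2
    have hprod : (d * (n : ZMod q)).valMinAbs = n * t - q := by
      have : d * (n : ZMod q) = ((n * t - q : ℤ) : ZMod q) := by
        push_cast; rw [htd, ZMod.natCast_self, sub_zero, mul_comm]
      rw [this]
      exact hval _ (by omega) (by omega)
    rw [hprod] at hbn
    have := D.sub_mem hbn hmul
    exact hqD (by convert this using 1; ring)
  · rw [ha] at hnt1 hnt2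
    have hprod : (d * (n : ZMod q)).valMinAbs = n * t + q := by
      have : d * (n : ZMod q) = ((n * t + q : ℤ) : ZMod q) := by
        push_cast; rw [htd, ZMod.natCast_self, add_zero, mul_comm]
      rw [this]
      rw [mul_neg] at hnt1 hnt2
      exact hval _ (by omega) (by omega)
    rw [hprod] at hbn
    have := D.sub_mem hmul hbn
    exact hqD (by convert this using 1; ring)

/-- The integers `m` for which `m γ` is an integer. -/
def integralMultiples (γ : ℝ) : AddSubgroup ℤ where
  carrier := {m | ∃ j : ℤ, γ * m = j}
  zero_mem' := ⟨0, by simp⟩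
  add_mem' := by
    rintro a b ⟨i, hi⟩ ⟨j, hj⟩
    exact ⟨i + j, by push_cast; rw [mul_add, hi, hj]⟩
  neg_mem' := by
    rintro a ⟨i, hi⟩
    exact ⟨-i, by push_cast; rw [mul_neg, hi]⟩

/-- The constellation over a prime `q ≥ 5`, with line averages bounded in terms of the distance
from `γ` to the integers only. -/
theorem goodConstellation_of_two_notMem [Fact q.Prime] (hsnr : 0 < snr) (hq5 : 5 ≤ q)
    (h2 : 2 ∉ integralMultiples γ) (hqD : (q : ℤ) ∉ integralMultiples γ) :
    GoodConstellation γ snr q (1 / (q : ℝ) + √((2 * Real.pi / 3) / snr))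
      ((1 + 1 / (q : ℝ)) * (1 / 2 + √((2 * Real.pi / 3) / snr) / |γ - round γ|)) := by
  have hprime : q.Prime := Fact.out
  have hq : Odd q := hprime.odd_of_ne_two (by omega)
  have hq0 : (0 : ℝ) < q := by exact_mod_cast hprime.pos
  have hq5' : (5 : ℝ) ≤ q := by exact_mod_cast hq5
  have h1 : 1 ∉ integralMultiples γ := fun h => h2 (by
    have := (integralMultiples γ).add_mem h h
    simpa using this)
  have hγ : γ - round γ ≠ 0 := fun h => h1 ⟨round γ, by push_cast; linarith⟩
  have hd0 : 0 < |γ - round γ| := abs_pos.2 hγ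
  have hd1 : |γ - round γ| ≤ 1 / 2 := abs_sub_round γ
  have hτ0 : 0 ≤ √((2 * Real.pi / 3) / snr) := Real.sqrt_nonneg _
  have hBq : (q : ℝ) * ((1 + 1 / (q : ℝ)) * (1 / 2 + √((2 * Real.pi / 3) / snr) / |γ - round γ|)) =
      (q + 1) * (1 / 2 + √((2 * Real.pi / 3) / snr) / |γ - round γ|) := by
    have : (q : ℝ) * (1 + 1 / (q : ℝ)) = q + 1 := by field_simp
    rw [← mul_assoc, this]
  refine ⟨fun a b => ?_, ?_, ?_⟩
  · have hb' : ∀ b' : ZMod q, ∑ a' : ZMod q, meanRatio snr (distScore snr)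
        (superposition γ a b - superposition γ a' b') ≤ 1 + √((2 * Real.pi / 3) / snr) * q := by
      intro b'
      have hsum : ∀ a' : ZMod q, superposition γ a b - superposition γ a' b' =
          (superposition γ a b - γ * constellation b') - constellation a' := by
        intro a'; simp only [superposition]; ring
      simp only [hsum]
      simpa using sum_meanRatio_constellation_le (q := q) hsnr
          (superposition γ a b - γ * constellation b') le_rfl (fun _ => abs_nonneg _)
    rw [Fintype.sum_prod_type_right]
    refine (Finset.sum_le_sum fun b' _ => hb' b').trans_eq ?_
    rw [Finset.sum_const, Finset.card_univ, ZMod.card, nsmul_eq_mul, mul_add, mul_add]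
    congr 1
    · field_simp
    · ring
  · rw [hBq]
    refine sum_line_le hsnr hq ?_ (sum_rotation_le_half hsnr (by omega) hγ)
    have : √((2 * Real.pi / 3) / snr) ≤ √((2 * Real.pi / 3) / snr) / |γ - round γ| :=
      le_div_self hτ0 hd0 (by linarith)
    nlinarith
  · refine exists_ne_of_forall_snd_eq fun T hT => ?_
    have hD : ∀ a b : ZMod q, b.valMinAbs - (T.2.2.1 * a + T.2.2.2 * b).valMinAbs ∈
        integralMultiples γ := by
      intro a b
      obtain ⟨k, hk⟩ := hT a b
      exact ⟨_, exists_superposition_sub_eq hk⟩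
    have hc : T.2.2.1 = 0 := by
      by_contra hc
      -- This input produces second label 1 where 0 was sent, which would make γ an integer.
      have h := hD T.2.2.1⁻¹ 0
      have hone : (1 : ZMod q).valMinAbs = 1 :=
        (ZMod.valMinAbs_spec _ _).2 ⟨by simp, by constructor <;> omega⟩
      rw [mul_zero, add_zero, mul_inv_cancel₀ hc, ZMod.valMinAbs_zero, zero_sub, hone] at h
      exact h1 (by simpa using (integralMultiples γ).neg_mem h)
    have hd : T.2.2.2 = 1 := eq_one_of_forall_valMinAbs_mul hq hq5 h1 h2 hqD fun b => by
      simpa [hc] using hD 0 b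
    intro a b
    rw [hc, hd]; simp

/-- By Bézout, two distinct primes in the subgroup would put 1 in it, so at most one prime is
excluded. -/
lemma exists_prime_notMem_integralMultiples (h1 : 1 ∉ integralMultiples γ) (N : ℕ) :
    ∃ q : ℕ, N ≤ q ∧ q.Prime ∧ (q : ℤ) ∉ integralMultiples γ := by
  obtain ⟨q₁, hN₁, hp₁⟩ := Nat.exists_infinite_primes N
  obtain ⟨q₂, hN₂, hp₂⟩ := Nat.exists_infinite_primes (q₁ + 1)
  by_contra hn
  push Not at hn
  have m1 := hn q₁ hN₁ hp₁
  have m2 := hn q₂ (by omega) hp₂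
  have hco : Nat.Coprime q₁ q₂ := (Nat.coprime_primes hp₁ hp₂).2 (by omega)
  obtain ⟨a, b, hab⟩ := Nat.isCoprime_iff_coprime.2 hco
  refine h1 (hab ▸ (integralMultiples γ).add_mem ?_ ?_)
  · rw [← smul_eq_mul]; exact (integralMultiples γ).zsmul_mem m1 a
  · rw [← smul_eq_mul]; exact (integralMultiples γ).zsmul_mem m2 b

end

end LinearMAC

/-! ### From the coding bound to achievable rates. -/

namespace LinearMAC

noncomputable section

variable {γ snr R : ℝ}

lemma achievable_of_nonpos (hR : R ≤ 0) : Achievable γ snr R := by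
  intro ε hε
  refine ⟨0, fun n _ => ⟨1, ⟨fun _ _ => 0, fun _ _ => ⟨?_, ?_⟩, fun _ => (0, 0), measurable_const⟩,
    ?_, ?_, ?_, ?_⟩⟩
  · linarith [L_pos]
  · linarith [L_pos]
  · rw [Nat.cast_one]
    exact Real.rpow_le_one_of_one_le_of_nonpos one_le_two
      (mul_nonpos_of_nonneg_of_nonpos n.cast_nonneg hR)
  · refine fun _ _ => ⟨0, ?_⟩
    ext t
    exact star_eq_of_mem ⟨by linarith [L_pos], by linarith [L_pos]⟩ 0 (by simp)
  · simp [Code.power]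
  · rw [Code.errorProb, Finset.sum_eq_zero, mul_zero]
    · exact hε
    · intro w _
      obtain rfl : w = (0, 0) := Subsingleton.elim _ _
      simp

lemma GoodConstellation.achievable {q : ℕ} [Fact q.Prime] {A B : ℝ}
    (hG : GoodConstellation γ snr q A B) (hsnr : 0 < snr) (hq : Odd q) (hA : 0 ≤ A) (hB : 0 ≤ B)
    (hR : 0 < R) (hRA : ((2 : ℝ) ^ R) ^ 2 * A < 1) (hRB : (2 : ℝ) ^ R * B < 1) :
    Achievable γ snr R := by
  obtain ⟨θ, hθ0, hθ1, hcode⟩ := hG.exists_code hsnr hq hA hB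
  have hq0 : (0 : ℝ) < q := by exact_mod_cast (Fact.out : q.Prime).pos
  set X := (2 : ℝ) ^ R with hX
  have hX1 : 1 < X := Real.one_lt_rpow one_lt_two hR
  have hX0 : 0 < X := by linarith
  have hlim : Filter.Tendsto (fun n : ℕ => ((q : ℝ) + 1) * X⁻¹ ^ n + ((q : ℝ) ^ 4 * θ ^ n +
      ((q : ℝ) ^ 2 + (q : ℝ) ^ 3) * q * (X * B) ^ n + (q : ℝ) ^ 2 * (X ^ 2 * A) ^ n))
      Filter.atTop (nhds 0) := by
    have h1 := (tendsto_pow_atTop_nhds_zero_of_lt_one (inv_nonneg.2 hX0.le)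
      (inv_lt_one_of_one_lt₀ hX1)).const_mul ((q : ℝ) + 1)
    have h2 := (tendsto_pow_atTop_nhds_zero_of_lt_one hθ0 hθ1).const_mul ((q : ℝ) ^ 4)
    have h3 := (tendsto_pow_atTop_nhds_zero_of_lt_one (by positivity) hRB).const_mul
      (((q : ℝ) ^ 2 + (q : ℝ) ^ 3) * q)
    have h4 := (tendsto_pow_atTop_nhds_zero_of_lt_one (by positivity) hRA).const_mul ((q : ℝ) ^ 2)
    simpa using h1.add ((h2.add h3).add h4)
  intro ε hε
  obtain ⟨N, hN⟩ := Filter.eventually_atTop.1 (hlim.eventually (gt_mem_nhds hε))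
  refine ⟨N, fun n hn => ?_⟩
  have hXn : (2 : ℝ) ^ ((n : ℝ) * R) = X ^ n := by
    rw [mul_comm, Real.rpow_mul two_pos.le, Real.rpow_natCast]
  have hq1 : (1 : ℝ) < q := by exact_mod_cast (Fact.out : q.Prime).one_lt
  -- Rounding the message count up to a power of q costs at most a factor q, which does not affect
  -- the exponential decay.
  obtain ⟨j, hj1, hj2⟩ := exists_nat_pow_near (one_le_pow₀ hX1.le (n := n)) hq1
  obtain ⟨C, hlin, hpow, herr⟩ := hcode (j + 1) n
  refine ⟨q ^ (j + 1), C, ?_, hlin, hpow, lt_of_le_of_lt (herr.trans ?_) (hN n hn)⟩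
  · rw [hXn]; push_cast; exact hj2.le
  · have hM : (q : ℝ) ^ (j + 1) ≤ q * X ^ n := by
      rw [pow_succ, mul_comm]
      gcongr
    have hXn0 : 0 < X ^ n := by positivity
    refine add_le_add ?_ (add_le_add (add_le_add le_rfl ?_) ?_)
    · rw [inv_pow, ← div_eq_mul_inv]
      gcongr
    · calc ((q : ℝ) ^ 2 + (q : ℝ) ^ 3) * (q : ℝ) ^ (j + 1) * B ^ n
          ≤ ((q : ℝ) ^ 2 + (q : ℝ) ^ 3) * (q * X ^ n) * B ^ n := by gcongr
        _ = _ := by rw [mul_pow]; ring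
    · calc ((q : ℝ) ^ (j + 1)) ^ 2 * A ^ n ≤ (q * X ^ n) ^ 2 * A ^ n := by gcongr
        _ = _ := by rw [mul_pow, mul_pow, ← pow_mul, ← pow_mul, mul_comm n 2]; ring

lemma two_rpow_sq_mul_lt_one {x : ℝ} (hx : 0 < x) (h : R < -(1 / 2) * Real.logb 2 x) :
    ((2 : ℝ) ^ R) ^ 2 * x < 1 := by
  have h1 : Real.logb 2 x < -(2 * R) := by linarith
  rw [Real.logb_lt_iff_lt_rpow one_lt_two hx, Real.rpow_neg two_pos.le] at h1
  have h2 : ((2 : ℝ) ^ R) ^ 2 = 2 ^ (2 * R) := by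
    rw [← Real.rpow_natCast, ← Real.rpow_mul two_pos.le, mul_comm]; norm_num
  rw [h2]
  have h3 : (0 : ℝ) < 2 ^ (2 * R) := by positivity
  calc (2 : ℝ) ^ (2 * R) * x < 2 ^ (2 * R) * (2 ^ (2 * R))⁻¹ := by gcongr
    _ = 1 := mul_inv_cancel₀ h3.ne'

lemma two_rpow_mul_lt_one {x : ℝ} (hx : 0 < x) (h : R < -Real.logb 2 x) :
    (2 : ℝ) ^ R * x < 1 := by
  have h1 : Real.logb 2 x < -R := by linarith
  rw [Real.logb_lt_iff_lt_rpow one_lt_two hx, Real.rpow_neg two_pos.le] at h1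
  have h3 : (0 : ℝ) < 2 ^ R := by positivity
  calc (2 : ℝ) ^ R * x < 2 ^ R * (2 ^ R)⁻¹ := by gcongr
    _ = 1 := mul_inv_cancel₀ h3.ne'

/-- The interval [-1/4, 1/4) has length 1/2, so if 2γ is an integer then γ reduces to 0 and the
defining inequality would have 1 on its left side. -/
lemma two_notMem_integralMultiples {p : ℕ} (hp : p ∈ admissiblePrimes γ snr) :
    2 ∉ integralMultiples γ := by
  rintro ⟨j, hj⟩
  have h := hp.2
  have h0 : modIco (-(1 / 4)) (1 / 4) (by norm_num) γ = 0 := by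
    rw [modIco, toIcoMod_eq_iff]
    refine ⟨⟨by norm_num, by norm_num⟩, j, ?_⟩
    rw [zsmul_eq_mul, ← hj]; push_cast; ring
  rw [h0] at h
  simp only [ne_eq, OfNat.ofNat_ne_zero, not_false_eq_true, zero_pow, mul_zero,
    Real.exp_zero] at h
  have : 0 ≤ 2 * (p : ℝ) * Real.exp (-(3 * snr / 8)) := by positivity
  linarith

/-- The binary constellation violates the power constraint; a constellation over a large prime
performs at least as well. -/
lemma achievable_of_lt_rate_two (hsnr : 0 < snr) (hR : 0 < R)
    (h2 : 2 ∉ integralMultiples γ) (hA : R < rateA γ snr 2) (hB : R < rateB γ snr 2) :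
    Achievable γ snr R := by
  have h1 : 1 ∉ integralMultiples γ := fun h => h2 (by
    have := (integralMultiples γ).add_mem h h
    simpa using this)
  have hγ : γ - round γ ≠ 0 := fun h => h1 ⟨round γ, by push_cast; linarith⟩
  have hd0 : 0 < |γ - round γ| := abs_pos.2 hγ
  have hA' := two_rpow_sq_mul_lt_one (by positivity) hA
  have hB' := two_rpow_mul_lt_one (by positivity) hB
  rw [delta_two] at hB'
  set d := |γ - round γ|
  have hτδ : √((2 * Real.pi / 3) / (d ^ 2 * snr)) = √((2 * Real.pi / 3) / snr) / d := by
    rw [mul_comm (d ^ 2), ← div_div, Real.sqrt_div (by positivity), Real.sqrt_sq hd0.le]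
  rw [hτδ] at hB'
  set τ := √((2 * Real.pi / 3) / snr)
  have hE := Real.exp_pos (-(3 * snr / 8))
  have hX : (0 : ℝ) < 2 ^ R := by positivity
  have hB2 : (2 : ℝ) ^ R * (1 / 2 + τ / d) < 1 := by
    refine lt_of_le_of_lt ?_ hB'
    push_cast
    exact mul_le_mul_of_nonneg_left (by linarith) hX.le
  -- The line constant for q tends to 1/2 + τ/d. The term 2exp(-3SNR/8) in the rate for p = 2 has
  -- been dropped, and the strict inequality absorbs the remaining factor 1 + 1/q.
  have hlim : Filter.Tendsto (fun q : ℕ => (2 : ℝ) ^ R * ((1 + 1 / (q : ℝ)) * (1 / 2 + τ / d)))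
      Filter.atTop (nhds ((2 : ℝ) ^ R * ((1 + 0) * (1 / 2 + τ / d)))) :=
    ((tendsto_one_div_atTop_nhds_zero_nat.const_add 1).mul_const _).const_mul _
  rw [add_zero, one_mul] at hlim
  obtain ⟨N, hN⟩ := Filter.eventually_atTop.1 (hlim.eventually (gt_mem_nhds hB2))
  obtain ⟨q, hq, hprime, hqD⟩ := exists_prime_notMem_integralMultiples h1 (max N 5)
  have hq5 : 5 ≤ q := (le_max_right _ _).trans hq
  have hq5' : (5 : ℝ) ≤ q := by exact_mod_cast hq5
  have : Fact q.Prime := ⟨hprime⟩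
  refine (goodConstellation_of_two_notMem hsnr hq5 h2 hqD).achievable hsnr
    (hprime.odd_of_ne_two (by omega)) (by positivity) (by positivity) hR ?_
    (hN q ((le_max_left _ _).trans hq))
  refine lt_of_le_of_lt ?_ hA'
  -- Since q ≥ 5, the term 1/q of the plane constant is below the 1/4 in the first rate for p = 2.
  have h4 : 1 / (q : ℝ) ≤ 1 / ((2 : ℕ) : ℝ) ^ 2 := by
    push_cast
    rw [div_le_div_iff₀ (by linarith) (by norm_num)]
    linarith
  have hE2 : 0 ≤ 1 / ((2 : ℕ) : ℝ) *
    Real.exp (-(3 * snr / (2 * ((2 : ℕ) : ℝ) ^ 2)) * delta 2 γ ^ 2) := by positivity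
  exact mul_le_mul_of_nonneg_left (by linarith) (by positivity)

end

end LinearMAC

theorem theorem1 (γ snr : ℝ) (hsnr : 0 < snr) (R : ℝ)
    (hR : (R : EReal) < LinearMAC.rateBound γ snr) :
    LinearMAC.Achievable γ snr R := by
  open LinearMAC in
  rcases le_or_gt R 0 with h0 | h0
  · exact achievable_of_nonpos h0
  simp only [rateBound, lt_iSup_iff] at hR
  obtain ⟨p, hp, hRp⟩ := hR
  rw [primeRate] at hRp
  split_ifs at hRp with hδ
  · exact absurd hRp not_lt_bot
  rw [EReal.coe_lt_coe_iff, lt_min_iff] at hRp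
  obtain ⟨hA, hB⟩ := hRp
  by_cases hp2 : p = 2
  · subst hp2
    exact achievable_of_lt_rate_two hsnr h0 (two_notMem_integralMultiples hp) hA hB
  · have hprime : Fact p.Prime := ⟨hp.1⟩
    have hp0 : (0 : ℝ) < p := by exact_mod_cast hp.1.pos
    have hodd : Odd p := hp.1.odd_of_ne_two hp2
    have hE := Real.exp_pos (-(3 * snr / 8))
    -- The arguments of the logarithms exceed the plane and line constants by 2exp(-3SNR/8), so both
    -- conditions follow by monotonicity.
    refine (goodConstellation_of_delta_ne_zero hsnr hodd hδ).achievable hsnr hodd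
      (by positivity) (by positivity) h0
      (lt_of_le_of_lt ?_ (two_rpow_sq_mul_lt_one (by positivity) hA))
      (lt_of_le_of_lt ?_ (two_rpow_mul_lt_one (by positivity) hB))
    · exact mul_le_mul_of_nonneg_left (by linarith) (by positivity)
    · exact mul_le_mul_of_nonneg_left (by linarith) (by positivity)
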